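/- All graphs are finite and simple. A tree decomposition of a graph $G=(V,E)$ consists of a tree $T$ and a bag $X_i\subseteq V$ for each node $i$ of $T$ such that every vertex lies in some bag, both endpoints of every edge lie in a common bag, and for every vertex $v$ the nodes whose bags contain $v$ induce a subtree of $T$. Its width is the largest bag size minus one; the treewidth of $G$ is the minimum width of a tree decomposition of $G$, and a tree decomposition attaining it is called optimal. A $k$-tree is a graph of treewidth $k$ in which adding any edge between two non-adjacent vertices increases the treewidth; a partial $k$-tree is a subgraph of a $k$-tree. In a rooted tree decomposition the edges of $T$, called links, are directed away from the root; in a link $(X,Y)$ the bag $X$ is the father of $Y$, and the link is labelled by $X\cap Y$. An optimal rooted tree decomposition is suitable if 1. every bag has size $3$ and $|X\cap Y|=2$ for any two adjacent bags $X,Y$ (smoothness), and 2. any two links with the same label have the same father: if $(X_1,Y_1)$ and $(X_2,Y_2)$ are links with $X_1\cap Y_1=X_2\cap Y_2$, then $X_1=X_2$. **Lemma.** There are a program for the unit-cost random access machine and a constant $C$ such that, given the number of vertices $n\ge 3$ and the list of edges (in any order) of a partial $2$-tree $G$ on the vertex set $\{0,\dots,n-1\}$, the program halts after at most $Cn$ steps,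 handling only numbers and memory addresses of size at most $Cn$, and outputs a rooted tree decomposition of $G$ that satisfies 1 and 2. The decomposition is output explicitly, by its number of bags, its root, the three vertices of every bag and the father of every bag other than the root, and this occupies at most $Cn$ words of memory. If $G$ has treewidth exactly $2$, the decomposition is also optimal, hence suitable. -/

import Mathlib

/-! ### Tree decompositions, treewidth, partial `k`-trees -/

/-- A tree decomposition of `G` whose bags are indexed by the nodes `ι` of a tree. -/
structure TreeDecomposition {V : Type*} (G : SimpleGraph V) (ι : Type*) where
  /-- the tree; its edges are called links -/
  tree : SimpleGraph ι
  isTree : tree.IsTree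
  bag : ι → Finset V
  cover_vertex : ∀ v : V, ∃ i, v ∈ bag i
  cover_edge : ∀ u v : V, G.Adj u v → ∃ i, u ∈ bag i ∧ v ∈ bag i
  /-- the nodes whose bags contain `v` induce a subtree -/
  subtree : ∀ v : V, (tree.induce {i | v ∈ bag i}).Preconnected

namespace TreeDecomposition

/-- The width: the largest bag size minus one. -/
def width {V : Type*} {G : SimpleGraph V} {ι : Type*} [Fintype ι]
    (T : TreeDecomposition G ι) : ℕ :=
  (Finset.univ.sup fun i => (T.bag i).card) - 1

end TreeDecomposition

/-- The treewidth of a finite graph: the least width of a (finite) tree decomposition.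
The one-bag decomposition shows that the infimum is over a nonempty set. -/
noncomputable def treewidth {V : Type*} (G : SimpleGraph V) : ℕ :=
  sInf {w | ∃ (r : ℕ) (T : TreeDecomposition G (Fin r)), T.width = w}

/-- A `k`-tree: a graph of treewidth `k` such that adding any edge between two distinct
non-adjacent vertices increases the treewidth. -/
def IsKTree {V : Type*} (k : ℕ) (G : SimpleGraph V) : Prop :=
  treewidth G = k ∧
    ∀ u v : V, u ≠ v → ¬ G.Adj u v → k < treewidth (G ⊔ SimpleGraph.edge u v)

/-- A partial `k`-tree: a graph that is (isomorphic to) a subgraph of a finite `k`-tree,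
possibly one with more vertices. -/
def IsPartialKTree {V : Type*} (k : ℕ) (G : SimpleGraph V) : Prop :=
  ∃ (N : ℕ) (H : SimpleGraph (Fin N)), IsKTree k H ∧ G.IsContained H

/-- A tree decomposition with a distinguished root node. -/
structure RootedTreeDecomposition {V : Type*} (G : SimpleGraph V) (ι : Type*) extends
    TreeDecomposition G ι where
  root : ι

namespace RootedTreeDecomposition

variable {V : Type*} {G : SimpleGraph V} {ι : Type*}

/-- `T.IsLink p c`: `(p, c)` is a link directed away from the root, so that `p` is the father
of `c`. -/
def IsLink (T : RootedTreeDecomposition G ι) (p c : ι) : Prop :=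
  T.tree.Adj p c ∧ T.tree.dist T.root p < T.tree.dist T.root c

/-- The label of the link `(p, c)`: the intersection of its two bags. -/
def label [DecidableEq V] (T : RootedTreeDecomposition G ι) (p c : ι) : Finset V :=
  T.bag p ∩ T.bag c

/-- Every bag has size `3` and adjacent bags share exactly two vertices. -/
def IsSmooth [DecidableEq V] (T : RootedTreeDecomposition G ι) : Prop :=
  (∀ i, (T.bag i).card = 3) ∧ ∀ i j, T.tree.Adj i j → (T.bag i ∩ T.bag j).card = 2

/-- Any two links with the same label have the same father. -/
def HasCommonFathers [DecidableEq V] (T : RootedTreeDecomposition G ι) : Prop :=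
  ∀ p₁ c₁ p₂ c₂, T.IsLink p₁ c₁ → T.IsLink p₂ c₂ → T.label p₁ c₁ = T.label p₂ c₂ → p₁ = p₂

/-- The decomposition attains the treewidth of the graph. -/
def IsOptimal [Fintype ι] (T : RootedTreeDecomposition G ι) : Prop :=
  T.width = treewidth G

/-- A suitable tree decomposition. -/
def IsSuitable [DecidableEq V] [Fintype ι] (T : RootedTreeDecomposition G ι) : Prop :=
  T.IsOptimal ∧ T.IsSmooth ∧ T.HasCommonFathers

end RootedTreeDecomposition

/-! ### A unit-cost random access machine

The machine has registers and arrays of natural numbers. A program is a finite term, so it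
mentions only finitely many registers and arrays (finitely many arrays can be interleaved in a
single memory with constant overhead). Arrays are addressed indirectly through registers. There
is no multiplication and there are no bit operations; each instruction and each test costs one
step. -/

namespace RAM

/-- The memory contents: `reg x` is the value of register `x`, and `arr A i` is the value of the
cell of array `A` at address `i`. -/
structure State where
  reg : ℕ → ℕ
  arr : ℕ → ℕ → ℕ

/-- Write `v` into register `x`. -/
def State.setReg (s : State) (x v : ℕ) : State where
  reg := Function.update s.reg x v
  arr := s.arr

/-- Write `v` into the cell of array `A` at address `i`. -/
def State.setArr (s : State) (A i v : ℕ) : State where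
  reg := s.reg
  arr := Function.update s.arr A (Function.update (s.arr A) i v)

/-- Comparisons of two registers. -/
inductive Test where
  | eq (x y : ℕ)
  | ne (x y : ℕ)
  | lt (x y : ℕ)
  | le (x y : ℕ)

/-- The test succeeds in the state `s`. -/
def Test.Holds (s : State) : Test → Prop
  | .eq x y => s.reg x = s.reg y
  | .ne x y => s.reg x ≠ s.reg y
  | .lt x y => s.reg x < s.reg y
  | .le x y => s.reg x ≤ s.reg y

/-- Programs; `x`, `y`, `z` are names of registers, `A` is the name of an array. -/
inductive Program where
  /-- do nothing -/
  | nop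
  /-- `x := k` -/
  | const (x k : ℕ)
  /-- `x := y` -/
  | move (x y : ℕ)
  /-- `x := y + z` -/
  | plus (x y z : ℕ)
  /-- `x := y - z`, or `0` if this is negative -/
  | minus (x y z : ℕ)
  /-- `x := A[y]` -/
  | load (x A y : ℕ)
  /-- `A[y] := x` -/
  | store (A y x : ℕ)
  /-- first `p`, then `q` -/
  | seq (p q : Program)
  /-- `if b then p else q` -/
  | branch (b : Test) (p q : Program)
  /-- `while b do p` -/
  | loop (b : Test) (p : Program)

/-- `Exec W p s t s'`: started in state `s`, the program `p` halts after exactly `t` steps in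
state `s'`, and no number larger than the word bound `W` is produced on the way. The machine gets
stuck, and no such relation holds, at an instruction whose result exceeds `W`; only constants and
sums can produce a number that was not bounded by one in the memory before. Since addresses are
contents of registers, they obey the same bound. -/
inductive Exec (W : ℕ) : Program → State → ℕ → State → Prop
  | nop (s) : Exec W .nop s 1 s
  | const (s x k) : k ≤ W → Exec W (.const x k) s 1 (s.setReg x k)
  | move (s x y) : Exec W (.move x y) s 1 (s.setReg x (s.reg y))
  | plus (s x y z) : s.reg y + s.reg z ≤ W →
      Exec W (.plus x y z) s 1 (s.setReg x (s.reg y + s.reg z))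
  | minus (s x y z) : Exec W (.minus x y z) s 1 (s.setReg x (s.reg y - s.reg z))
  | load (s x A y) : Exec W (.load x A y) s 1 (s.setReg x (s.arr A (s.reg y)))
  | store (s A y x) : Exec W (.store A y x) s 1 (s.setArr A (s.reg y) (s.reg x))
  | seq {p q s s₁ s₂ t₁ t₂} : Exec W p s t₁ s₁ → Exec W q s₁ t₂ s₂ →
      Exec W (.seq p q) s (t₁ + t₂) s₂
  | branch_true {b p q s s₁ t} : b.Holds s → Exec W p s t s₁ →
      Exec W (.branch b p q) s (t + 1) s₁
  | branch_false {b p q s s₁ t} : ¬ b.Holds s → Exec W q s t s₁ →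
      Exec W (.branch b p q) s (t + 1) s₁
  | loop_true {b p s s₁ s₂ t₁ t₂} : b.Holds s → Exec W p s t₁ s₁ →
      Exec W (.loop b p) s₁ t₂ s₂ → Exec W (.loop b p) s (t₁ + t₂ + 1) s₂
  | loop_false {b p s} : ¬ b.Holds s → Exec W (.loop b p) s 1 s

end RAM

/-! ### Input and output formats -/

/-- `es` lists every edge of `G` exactly once, in any order and with the two endpoints of each
edge in any order. -/
def IsEdgeList {n : ℕ} (G : SimpleGraph (Fin n)) (es : List (Fin n × Fin n)) : Prop :=
  (es.map fun e => s(e.1, e.2)).Nodup ∧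
    ∀ u v : Fin n, G.Adj u v ↔ s(u, v) ∈ es.map fun e => s(e.1, e.2)

/-- The initial state for a graph on `n` vertices with edge list `es`: register `0` holds `n`,
register `1` holds the number of edges, arrays `0` and `1` hold the first and the second endpoints
of the edges, and everything else is `0`. -/
def graphInput (n : ℕ) (es : List (Fin n × Fin n)) : RAM.State where
  reg x := if x = 0 then n else if x = 1 then es.length else 0
  arr A i :=
    if A = 0 then (es.map fun e => (e.1 : ℕ)).getD i 0
    else if A = 1 then (es.map fun e => (e.2 : ℕ)).getD i 0
    else 0

/-- The state `s` stores the rooted tree decomposition `T` (with bags of at most three vertices)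
explicitly: register `0` holds the number `r` of bags, register `1` the root, arrays `0`, `1`, `2`
the vertices of each bag, and array `3` the father of each bag other than the root. -/
def Stores {n r : ℕ} {G : SimpleGraph (Fin n)} (s : RAM.State)
    (T : RootedTreeDecomposition G (Fin r)) : Prop :=
  s.reg 0 = r ∧ s.reg 1 = T.root ∧
    (∀ i : Fin r, (T.bag i).image (fun v : Fin n => (v : ℕ)) = {s.arr 0 i, s.arr 1 i, s.arr 2 i}) ∧
    ∀ p c : Fin r, T.IsLink p c ↔ c ≠ T.root ∧ s.arr 3 c = p

/-- The number of memory words that the above representation of a rooted tree decomposition with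
`r` bags occupies: two registers and four array cells for each bag. -/
def storageWords (r : ℕ) : ℕ := 4 * r + 2

/-! The decomposition comes from eliminating vertices with at most two neighbours. In a rooted
decomposition with bags of size at most three, a vertex whose topmost bag is deepest has all its
neighbours in that bag, hence at most two of them (`HasWidthTwo.exists_low`). Deleting such a vertex
and joining its neighbours is a deletion or the contraction of an edge, so the width bound persists
(`HasWidthTwo.contract`) and the process never gets stuck. The same existence statement bounds the
number of edges by `2 * n`, so a bound linear in vertices and edges is linear in `n`.

Let the vertices get the ranks `n, …, 1` in the order of elimination. A vertex of rank `k ≥ 3` is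
attached to a pair of ranks `lo k < hi k < k` containing those of its neighbours at elimination. Two
such neighbours are joined at that time, so the one of smaller rank is later recorded as a neighbour
of the other; with at most one neighbour the pair can be completed freely. Hence `lo k` belongs to
the pair of `hi k` whenever `hi k ≥ 3`, and the bag `{k, hi k, lo k}` can hang below the bag of `hi
k`, or below the root bag `{3, 2, 1}` if the pair is `{2, 1}`. The label of the link is the pair
itself, and its larger element determines the father: this is the second condition of suitability
(`PairAttachment.exists_decomposition`).

For linear time, the adjacency lists are lazy: they may contain repetitions and eliminated vertices.
A queue contains every vertex that is currently low. Examining a vertex scans its list only until a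
third distinct neighbour appears, and the part already read is then replaced by these three entries.
A potential counting queue entries, remaining vertices and list cells pays for all scans
(`runs_scan`, `runs_eliminate`, `runs_reduce`). Programs are verified with a time credit that each
step decreases, so that the potential can serve as a loop invariant. -/

/-! ### Width-two certificates -/

/-- A certificate that the relation `E` has treewidth at most two: a rooted forest of bags with at
most three elements each, in which every pair related by `E` shares a bag, and the bags containing
a given element have only one topmost node. -/
structure WidthTwoCert (E : ℕ → ℕ → Prop) where
  ι : Type
  depth : ι → ℕ
  par : ι → ι
  root : ι
  bag : ι → Finset ℕ
  depth_par : ∀ j, j ≠ root → depth (par j) < depth j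
  card_le : ∀ j, (bag j).card ≤ 3
  cover : ∀ u v, E u v → ∃ j, u ∈ bag j ∧ v ∈ bag j
  top_unique : ∀ v i j, v ∈ bag i → v ∈ bag j → (i = root ∨ v ∉ bag (par i)) →
    (j = root ∨ v ∉ bag (par j)) → i = j

/-- The relation `E` has treewidth at most two. -/
def HasWidthTwo (E : ℕ → ℕ → Prop) : Prop := Nonempty (WidthTwoCert E)

theorem HasWidthTwo.mono {E F : ℕ → ℕ → Prop} (h : HasWidthTwo E) (hF : ∀ u v, F u v → E u v) :
    HasWidthTwo F := by
  obtain ⟨c⟩ := h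
  exact ⟨{ c with cover := fun u v huv => c.cover u v (hF u v huv) }⟩

namespace WidthTwoCert

variable {E : ℕ → ℕ → Prop} (c : WidthTwoCert E)

/-- Depths are natural numbers, and the father of a node of least depth is shallower, so it cannot
satisfy `p`. Applied to the bags containing a vertex or a pair, this gives their topmost node. -/
theorem exists_min {p : c.ι → Prop} (h : ∃ j, p j) :
    ∃ j, p j ∧ (∀ i, p i → c.depth j ≤ c.depth i) ∧ (j = c.root ∨ ¬ p (c.par j)) := by
  classical
  have hex : ∃ k, ∃ j, p j ∧ c.depth j = k := by
    obtain ⟨j, hj⟩ := h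
    exact ⟨_, j, hj, rfl⟩
  obtain ⟨j, hj, hk⟩ := Nat.find_spec hex
  have hmin : ∀ i, p i → c.depth j ≤ c.depth i := fun i hi => by
    rw [hk]
    exact Nat.find_min' hex ⟨i, hi, rfl⟩
  refine ⟨j, hj, hmin, ?_⟩
  by_contra! hcon
  exact absurd (hmin _ hcon.2) (not_le.2 (c.depth_par j hcon.1))

end WidthTwoCert

/-- Among finitely many elements some element has at most two neighbours. -/
theorem HasWidthTwo.exists_low {E : ℕ → ℕ → Prop} (h : HasWidthTwo E) (S : Finset ℕ)
    (hS : S.Nonempty) (hE : ∀ u v, E u v → u ≠ v ∧ u ∈ S ∧ v ∈ S) :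
    ∃ v ∈ S, ∃ x y, ∀ w, E v w → w = x ∨ w = y := by
  classical
  obtain ⟨c⟩ := h
  -- The depth of the topmost bag of `v`; the junk value `0` for a vertex in no bag is harmless. The
  -- vertex maximising it is the low one.
  let D : ℕ → ℕ := fun v => sInf {k | ∃ j, v ∈ c.bag j ∧ c.depth j = k}
  have hD : ∀ v j, v ∈ c.bag j → D v ≤ c.depth j := fun v j hj => Nat.sInf_le ⟨j, hj, rfl⟩
  obtain ⟨v, hvS, hmax⟩ := S.exists_max_image D hS
  refine ⟨v, hvS, ?_⟩
  by_cases hv : ∃ j, v ∈ c.bag j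
  · obtain ⟨t, ht, htmin, httop⟩ := c.exists_min hv
    have key : ∀ w, E v w → w ∈ (c.bag t).erase v := by
      intro w hw
      obtain ⟨hne, -, hwS⟩ := hE v w hw
      obtain ⟨j, ⟨hvj, hwj⟩, -, hj⟩ := c.exists_min (c.cover v w hw)
      refine Finset.mem_erase.2 ⟨hne.symm, ?_⟩
      by_cases hjt : j = c.root ∨ v ∉ c.bag (c.par j)
      · rwa [c.top_unique v t j ht hvj httop hjt]
      push Not at hjt
      have hwtop : w ∉ c.bag (c.par j) := fun hcon => by
        rcases hj with hj | hj
        · exact hjt.1 hj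
        · exact hj ⟨hjt.2, hcon⟩
      -- the node `j` is the top of `w`, so it is not deeper than the top of `v`
      obtain ⟨i, hwi, himin, hitop⟩ := c.exists_min (p := fun i => w ∈ c.bag i) ⟨j, hwj⟩
      have hij : i = j := c.top_unique w i j hwi hwj hitop (Or.inr hwtop)
      subst hij
      have h1 : c.depth i ≤ D w := le_csInf ⟨_, i, hwj, rfl⟩ (by
        rintro k ⟨i', hi', rfl⟩
        exact himin i' hi')
      have h2 := hmax w hwS
      have h3 := hD v _ hjt.2
      have h4 := c.depth_par i hjt.1
      omega
    have hcard : ((c.bag t).erase v).card ≤ 2 := by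
      rw [Finset.card_erase_of_mem ht]
      have := c.card_le t
      omega
    obtain ⟨x, y, hxy⟩ : ∃ x y, (c.bag t).erase v ⊆ {x, y} := by
      have h3 : ((c.bag t).erase v).card = 0 ∨ ((c.bag t).erase v).card = 1 ∨
          ((c.bag t).erase v).card = 2 := by omega
      rcases h3 with h3 | h3 | h3
      · exact ⟨0, 0, by simp [Finset.card_eq_zero.1 h3]⟩
      · obtain ⟨a, ha⟩ := Finset.card_eq_one.1 h3
        exact ⟨a, a, by simp [ha]⟩
      · obtain ⟨a, b, -, ha⟩ := Finset.card_eq_two.1 h3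
        exact ⟨a, b, by simp [ha]⟩
    exact ⟨x, y, fun w hw => by simpa using hxy (key w hw)⟩
  · refine ⟨0, 0, fun w hw => ?_⟩
    obtain ⟨j, hj, -⟩ := c.cover v w hw
    exact absurd ⟨j, hj⟩ hv

/-- Contracting an edge does not increase the treewidth. -/
theorem HasWidthTwo.contract {E F : ℕ → ℕ → Prop} (h : HasWidthTwo E) {v x : ℕ} (hvx : E v x)
    (hne : v ≠ x)
    (hF : ∀ u w, F u w → u ≠ v ∧ w ≠ v ∧ (E u w ∨ (u = x ∧ E v w) ∨ (w = x ∧ E v u))) :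
    HasWidthTwo F := by
  classical
  obtain ⟨c⟩ := h
  -- Replacing `v` by `x` in every bag does not enlarge any bag; the nodes of the new `x` are the
  -- union of the nodes of `v` and of `x`.
  let bag : c.ι → Finset ℕ := fun j =>
    if v ∈ c.bag j then insert x ((c.bag j).erase v) else c.bag j
  have hx : ∀ j, x ∈ bag j ↔ x ∈ c.bag j ∨ v ∈ c.bag j := fun j => by
    by_cases hj : v ∈ c.bag j <;> simp [bag, hj]
  have hv : ∀ j, v ∉ bag j := fun j => by
    by_cases hj : v ∈ c.bag j <;> simp [bag, hj, hne]
  have ho : ∀ u j, u ≠ x → u ≠ v → (u ∈ bag j ↔ u ∈ c.bag j) := fun u j h1 h2 => by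
    by_cases hj : v ∈ c.bag j <;> simp [bag, hj, h1, h2]
  have hsub : ∀ u j, u ≠ v → u ∈ c.bag j → u ∈ bag j := fun u j h1 h2 => by
    by_cases hj : v ∈ c.bag j <;> simp [bag, hj, h1, h2]
  refine ⟨{ c with bag := bag, card_le := ?_, cover := ?_, top_unique := ?_ }⟩
  · intro j
    by_cases hj : v ∈ c.bag j
    · have h1 := Finset.card_insert_le x ((c.bag j).erase v)
      have h2 := Finset.card_erase_add_one hj
      have h3 := c.card_le j
      simp only [bag, hj, if_true]
      omega
    · simpa [bag, hj] using c.card_le j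
  · intro u w huw
    obtain ⟨hu, hw, h1 | ⟨rfl, h1⟩ | ⟨rfl, h1⟩⟩ := hF u w huw
    · obtain ⟨j, hj1, hj2⟩ := c.cover u w h1
      exact ⟨j, hsub u j hu hj1, hsub w j hw hj2⟩
    · obtain ⟨j, hj1, hj2⟩ := c.cover v w h1
      exact ⟨j, (hx j).2 (Or.inr hj1), hsub w j hw hj2⟩
    · obtain ⟨j, hj1, hj2⟩ := c.cover v u h1
      exact ⟨j, hsub u j hu hj2, (hx j).2 (Or.inr hj1)⟩
  · intro u i j hi hj hit hjt
    by_cases huv : u = v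
    · exact absurd (huv ▸ hi) (hv i)
    by_cases hux : u = x
    · subst hux
      simp only [hx, not_or] at hi hj hit hjt
      -- The contracted edge lies in a bag, so the two subtrees meet; this is what gives their union
      -- a single top.
      obtain ⟨k, ⟨hvk, hxk⟩, -, hk⟩ := c.exists_min (c.cover v u hvx)
      -- `k` is the top of `v` or of `u`, and hence every top of the union
      have tv : ∀ i, v ∈ c.bag i → (i = c.root ∨ u ∉ c.bag (c.par i) ∧ v ∉ c.bag (c.par i)) →
          ∀ k', v ∈ c.bag k' → (k' = c.root ∨ v ∉ c.bag (c.par k')) → i = k' :=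
        fun i h1 h2 k' h3 h4 => c.top_unique v i k' h1 h3 (h2.imp_right And.right) h4
      have tu : ∀ i, u ∈ c.bag i → (i = c.root ∨ u ∉ c.bag (c.par i) ∧ v ∉ c.bag (c.par i)) →
          ∀ k', u ∈ c.bag k' → (k' = c.root ∨ u ∉ c.bag (c.par k')) → i = k' :=
        fun i h1 h2 k' h3 h4 => c.top_unique u i k' h1 h3 (h2.imp_right And.left) h4
      have hk' : (k = c.root ∨ v ∉ c.bag (c.par k)) ∨ (k = c.root ∨ u ∉ c.bag (c.par k)) := by
        tauto
      rcases hi with hi | hi <;> rcases hj with hj | hj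
      · exact c.top_unique u i j hi hj (hit.imp_right And.left) (hjt.imp_right And.left)
      · rcases hk' with hk' | hk'
        · have := tv j hj hjt k hvk hk'
          subst this
          exact tu i hi hit j hxk (hjt.imp_right And.left)
        · have := tu i hi hit k hxk hk'
          subst this
          exact (tv j hj hjt i hvk (hit.imp_right And.right)).symm
      · rcases hk' with hk' | hk'
        · have := tv i hi hit k hvk hk'
          subst this
          exact (tu j hj hjt i hxk (hit.imp_right And.left)).symm
        · have := tu j hj hjt k hxk hk'
          subst this
          exact tv i hi hit j hvk (hjt.imp_right And.right)
      · exact c.top_unique v i j hi hj (hit.imp_right And.right) (hjt.imp_right And.right)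
    · simp only [ho u _ hux huv] at hi hj hit hjt
      exact c.top_unique u i j hi hj hit hjt

open Classical in
/-- A relation of treewidth at most two on `s` elements has at most `2 * s` edges. -/
theorem HasWidthTwo.card_edges_le {E : ℕ → ℕ → Prop} (h : HasWidthTwo E)
    (hirr : ∀ u v, E u v → u ≠ v) (F : Finset (Sym2 ℕ))
    (hF : ∀ u v, s(u, v) ∈ F → E u v) (S : Finset ℕ) :
    (F.filter fun e => ∀ a ∈ e, a ∈ S).card ≤ 2 * S.card := by
  classical
  induction S using Finset.strongInduction with
  | H S ih =>
    rcases S.eq_empty_or_nonempty with rfl | hS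
    · simp only [Finset.notMem_empty, Finset.card_empty, mul_zero, Nat.le_zero_eq,
        Finset.card_eq_zero, Finset.filter_eq_empty_iff]
      intro e _ hcon
      exact hcon _ e.out_fst_mem
    -- The relation is restricted to `S`; deleting its low vertex loses at most the two edges to `x`
    -- and `y`.
    · obtain ⟨v, hv, x, y, hxy⟩ := (h.mono (F := fun u v => E u v ∧ u ∈ S ∧ v ∈ S)
        fun u v huv => huv.1).exists_low S hS fun u v huv => ⟨hirr u v huv.1, huv.2⟩
      have hsub : (F.filter fun e => ∀ a ∈ e, a ∈ S) ⊆
          (F.filter fun e => ∀ a ∈ e, a ∈ S.erase v) ∪ {s(v, x), s(v, y)} := by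
        intro e he
        rw [Finset.mem_filter] at he
        by_cases hve : v ∈ e
        · obtain ⟨w, rfl⟩ := Sym2.mem_iff_exists.1 hve
          have := hxy w ⟨hF v w he.1, hv, he.2 w (by simp)⟩
          rcases this with rfl | rfl <;> simp
        · refine Finset.mem_union_left _ (Finset.mem_filter.2 ⟨he.1, fun a ha => ?_⟩)
          exact Finset.mem_erase.2 ⟨fun hav => hve (hav ▸ ha), he.2 a ha⟩
      have h1 := ih (S.erase v) (Finset.erase_ssubset hv)
      have h2 := Finset.card_le_card hsub
      have h3 := Finset.card_union_le (F.filter fun e => ∀ a ∈ e, a ∈ S.erase v)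
        {s(v, x), s(v, y)}
      have h4 : ({s(v, x), s(v, y)} : Finset (Sym2 ℕ)).card ≤ 2 := Finset.card_le_two
      have h5 := Finset.card_erase_add_one hv
      omega

/-! ### Certificates from tree decompositions -/

namespace SimpleGraph.IsTree

variable {ι : Type*} {T : SimpleGraph ι}

/-- A geodesic from `r` to a closer neighbour, extended by `j`, is a path with that neighbour next
to last, and a tree has only one path from `r` to `j`. -/
theorem eq_of_adj_of_dist_lt (hT : T.IsTree) {r p q j : ι} (hp : T.Adj p j) (hq : T.Adj q j)
    (hpd : T.dist r p < T.dist r j) (hqd : T.dist r q < T.dist r j) : p = q := by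
  have key : ∀ p, T.Adj p j → T.dist r p < T.dist r j →
      ∃ w : T.Walk r j, w.IsPath ∧ w.penultimate = p := by
    intro p hp hpd
    obtain ⟨w, hw⟩ := hT.connected.exists_walk_length_eq_dist r p
    have hd := hT.dist_eq_dist_add_one_of_adj r hp
    refine ⟨w.concat hp, ?_, by simp⟩
    apply SimpleGraph.Walk.isPath_of_length_eq_dist
    rw [SimpleGraph.Walk.length_concat, hw]
    omega
  obtain ⟨w₁, h₁, rfl⟩ := key p hp hpd
  obtain ⟨w₂, h₂, rfl⟩ := key q hq hqd
  have := congrArg Subtype.val ((hT.isAcyclic.subsingleton_path r j).elim ⟨w₁, h₁⟩ ⟨w₂, h₂⟩)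
  simp only at this
  rw [this]

/-- The first step of a geodesic from `j` to `r` leads to such a neighbour. -/
theorem exists_adj_dist_lt (hT : T.IsTree) {r j : ι} (hj : j ≠ r) :
    ∃ p, T.Adj p j ∧ T.dist r p < T.dist r j := by
  obtain ⟨w, hw⟩ := hT.connected.exists_walk_length_eq_dist j r
  cases w with
  | nil => exact absurd rfl hj
  | cons h w =>
    rename_i p
    refine ⟨p, h.symm, ?_⟩
    have := SimpleGraph.dist_le w
    rw [SimpleGraph.Walk.length_cons] at hw
    rw [SimpleGraph.dist_comm, SimpleGraph.dist_comm (u := r) (v := j)]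
    omega

end SimpleGraph.IsTree

/-- A tree decomposition with bags of at most three vertices gives a certificate for every relation
that embeds into the graph. -/
theorem TreeDecomposition.hasWidthTwo {n N r : ℕ} {H : SimpleGraph (Fin N)}
    (D : TreeDecomposition H (Fin r)) (hD : ∀ i, (D.bag i).card ≤ 3) (f : Fin n → Fin N)
    (hf : Function.Injective f) (E : ℕ → ℕ → Prop)
    (hE : ∀ u v, E u v → ∃ a b : Fin n, (a : ℕ) = u ∧ (b : ℕ) = v ∧ H.Adj (f a) (f b)) :
    HasWidthTwo E := by
  classical
  obtain ⟨ρ⟩ := D.isTree.connected.nonempty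
  have hpar : ∀ j, ∃ p, j ≠ ρ → D.tree.Adj p j ∧ D.tree.dist ρ p < D.tree.dist ρ j := by
    intro j
    by_cases hj : j = ρ
    · exact ⟨j, fun h => absurd hj h⟩
    · obtain ⟨p, hp⟩ := D.isTree.exists_adj_dist_lt hj
      exact ⟨p, fun _ => hp⟩
  choose par hpar using hpar
  let bag : Fin r → Finset ℕ := fun i =>
    (Finset.univ.filter fun a : Fin n => f a ∈ D.bag i).image Fin.val
  have hbag : ∀ (a : Fin n) i, (a : ℕ) ∈ bag i ↔ f a ∈ D.bag i := fun a i => by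
    simp [bag, Fin.val_inj]
  refine ⟨{
    ι := Fin r, depth := D.tree.dist ρ, par := par, root := ρ, bag := bag
    depth_par := fun j hj => (hpar j hj).2
    card_le := fun j => ?_
    cover := fun u v huv => ?_
    top_unique := fun v i j hi hj hit hjt => ?_ }⟩
  · refine le_trans Finset.card_image_le (le_trans ?_ (hD j))
    exact Finset.card_le_card_of_injOn f (fun a ha => by simpa using ha) hf.injOn
  · obtain ⟨a, b, rfl, rfl, hab⟩ := hE u v huv
    obtain ⟨j, h1, h2⟩ := D.cover_edge _ _ hab
    exact ⟨j, (hbag a j).2 h1, (hbag b j).2 h2⟩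
  · obtain ⟨a, -, rfl⟩ := Finset.mem_image.1 hi
    rw [hbag] at hi hj hit hjt
    have hstep : ∀ x y, D.tree.Adj x y → (y ≠ ρ ∧ x = par y) ∨ (x ≠ ρ ∧ y = par x) := by
      have aux : ∀ x y, D.tree.Adj x y → D.tree.dist ρ x < D.tree.dist ρ y →
          y ≠ ρ ∧ x = par y := by
        intro x y hxy hd
        have hy : y ≠ ρ := by
          rintro rfl
          simp at hd
        exact ⟨hy, D.isTree.eq_of_adj_of_dist_lt hxy (hpar y hy).1 hd (hpar y hy).2⟩
      intro x y hxy
      rcases D.isTree.dist_eq_dist_add_one_of_adj ρ hxy with h | h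
      · exact Or.inr (aux y x hxy.symm (by omega))
      · exact Or.inl (aux x y hxy (by omega))
    -- `A x` says that climbing from `x` through bags containing the vertex arrives at the top `i`.
    -- A walk in the subtree preserves this: a downward step prepends a link and an upward step
    -- removes one; from `i` itself no upward step is possible. As `j` is also a top, its climb is
    -- empty and `j = i`.
    let A : Fin r → Prop := fun x => Relation.ReflTransGen
      (fun p q => p ≠ ρ ∧ q = par p ∧ f a ∈ D.bag q) x i
    have hreach : ∀ (y z : {k | f a ∈ D.bag k}), (D.tree.induce {k | f a ∈ D.bag k}).Walk y z →
        A y → A z := by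
      intro y z w
      induction w with
      | nil => exact id
      | @cons y z' _ h _ ih =>
        intro hy
        apply ih
        have hadj : D.tree.Adj y z' := h
        rcases hstep _ _ hadj with ⟨h1, h2⟩ | ⟨h1, h2⟩
        · exact Relation.ReflTransGen.head ⟨h1, h2, y.2⟩ hy
        · rcases Relation.ReflTransGen.cases_head hy with h3 | ⟨q, ⟨h3, h4, h5⟩, h6⟩
          · exfalso
            have hz : f a ∈ D.bag z' := z'.2
            rw [h2, h3] at hz
            rcases hit with hit | hit
            · exact h1 (h3.trans hit)
            · exact hit hz
          · rw [h2, ← h4]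
            exact h6
    obtain ⟨w⟩ := D.subtree (f a) ⟨i, hi⟩ ⟨j, hj⟩
    have hAj : A j := hreach _ _ w Relation.ReflTransGen.refl
    rcases Relation.ReflTransGen.cases_head hAj with h3 | ⟨q, ⟨h3, h4, h5⟩, h6⟩
    · exact h3.symm
    · rcases hjt with hjt | hjt
      · exact absurd hjt h3
      · exact absurd (h4 ▸ h5) hjt

theorem IsPartialKTree.hasWidthTwo {n : ℕ} {G : SimpleGraph (Fin n)} (hG : IsPartialKTree 2 G) :
    HasWidthTwo fun u v => ∃ a b : Fin n, (a : ℕ) = u ∧ (b : ℕ) = v ∧ G.Adj a b := by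
  obtain ⟨N, H, ⟨hH, -⟩, ⟨f⟩⟩ := hG
  have hmem : 2 ∈ {w | ∃ (r : ℕ) (T : TreeDecomposition H (Fin r)), T.width = w} := by
    rw [← hH]
    refine Nat.sInf_mem ?_
    -- Without decompositions the infimum would be `0`, not `2`; so it is attained.
    by_contra hcon
    rw [Set.not_nonempty_iff_eq_empty] at hcon
    rw [treewidth, hcon] at hH
    simp at hH
  obtain ⟨r, D, hD⟩ := hmem
  refine D.hasWidthTwo (fun i => ?_) f f.injective _ ?_
  · have h1 : (D.bag i).card ≤ Finset.univ.sup fun i => (D.bag i).card :=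
      Finset.le_sup (f := fun i => (D.bag i).card) (Finset.mem_univ i)
    unfold TreeDecomposition.width at hD
    omega
  · rintro u v ⟨a, b, hu, hv, hab⟩
    exact ⟨a, b, hu, hv, f.toHom.map_adj hab⟩

/-! ### Trees given by a father function -/

/-- The graph on `{0, …, r - 1}` in which every `j ≠ 0` is joined to its father `f j`. -/
def fatherGraph (r : ℕ) (f : ℕ → ℕ) : SimpleGraph (Fin r) :=
  SimpleGraph.fromRel fun i j => 0 < (j : ℕ) ∧ f j = i

namespace fatherGraph

variable {r : ℕ} {f : ℕ → ℕ}

theorem adj_iff (hf : ∀ j, 0 < j → j < r → f j < j) {i j : Fin r} :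
    (fatherGraph r f).Adj i j ↔ (0 < (j : ℕ) ∧ f j = i) ∨ (0 < (i : ℕ) ∧ f i = j) := by
  rw [fatherGraph, SimpleGraph.fromRel_adj]
  refine ⟨And.right, fun h => ⟨?_, h⟩⟩
  rintro rfl
  rcases h with h | h <;> exact absurd (hf i h.1 i.2) (by omega)

/-- Descending along `f` reaches `0`, so the graph is connected; each edge comes from some `j ≠ 0`,
so there are at most `r - 1` edges. -/
theorem isTree (hf : ∀ j, 0 < j → j < r → f j < j) (hr : 0 < r) : (fatherGraph r f).IsTree := by
  classical
  have hreach : ∀ k (hk : k < r), (fatherGraph r f).Reachable ⟨k, hk⟩ ⟨0, hr⟩ := by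
    intro k
    induction k using Nat.strong_induction_on with
    | _ k ih =>
      intro hk
      rcases Nat.eq_zero_or_pos k with rfl | h0
      · exact SimpleGraph.Reachable.refl _
      · have h1 := hf k h0 hk
        have hadj : (fatherGraph r f).Adj ⟨k, hk⟩ ⟨f k, h1.trans hk⟩ :=
          (adj_iff hf).2 (Or.inr ⟨h0, rfl⟩)
        exact hadj.reachable.trans (ih _ h1 _)
  have hconn : (fatherGraph r f).Connected :=
    { preconnected := fun i j => (hreach i i.2).trans (hreach j j.2).symm
      nonempty := ⟨⟨0, hr⟩⟩ }
  refine SimpleGraph.isTree_iff_connected_and_card.2 ⟨hconn, le_antisymm ?_ ?_⟩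
  -- The fallback `j` only makes `e` total: for `j ≠ 0` the value `f j` is below `r`.
  · let e : Fin r → Sym2 (Fin r) := fun j =>
      s(j, if h : f j < r then ⟨f j, h⟩ else j)
    have hsub : (fatherGraph r f).edgeSet ⊆
        (((Finset.univ.erase (⟨0, hr⟩ : Fin r)).image e : Finset _) : Set (Sym2 (Fin r))) := by
      intro a
      induction a using Sym2.ind with
      | _ i j =>
        rw [SimpleGraph.mem_edgeSet, adj_iff hf]
        simp only [Finset.coe_image, Set.mem_image, Finset.mem_coe, Finset.mem_erase,
          Finset.mem_univ, and_true]
        rintro (⟨h1, h2⟩ | ⟨h1, h2⟩)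
        · refine ⟨j, fun h => by simp [h] at h1, ?_⟩
          simp only [e, h2, i.2, dite_true]
          exact Sym2.eq_swap
        · refine ⟨i, fun h => by simp [h] at h1, ?_⟩
          simp only [e, h2, j.2, dite_true]
    have h1 := Set.ncard_le_ncard hsub (Finset.finite_toSet _)
    rw [Set.ncard_coe_finset] at h1
    have h2 := Finset.card_image_le (s := Finset.univ.erase (⟨0, hr⟩ : Fin r)) (f := e)
    rw [Finset.card_erase_of_mem (Finset.mem_univ _), Finset.card_univ, Fintype.card_fin] at h2
    rw [Nat.card_coe_set_eq, Nat.card_eq_fintype_card, Fintype.card_fin]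
    omega
  · exact hconn.card_vert_le_card_edgeSet_add_one

/-- By downward induction on `c`. Some neighbour of `c` is closer to the root; if it were a child `q
> c`, the induction hypothesis for `q` would make `c` closer than `q`. So it is the father. -/
theorem dist_lt (hf : ∀ j, 0 < j → j < r → f j < j) (hr : 0 < r) (c p : Fin r)
    (hc : 0 < (c : ℕ)) (hp : f c = p) :
    (fatherGraph r f).dist ⟨0, hr⟩ p < (fatherGraph r f).dist ⟨0, hr⟩ c := by
  induction hk : r - c using Nat.strong_induction_on generalizing c p with
  | _ k ih =>
    have hadj : (fatherGraph r f).Adj p c := (adj_iff hf).2 (Or.inl ⟨hc, hp⟩)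
    have hT := isTree hf hr
    obtain ⟨q, hq, hqd⟩ := hT.exists_adj_dist_lt (r := ⟨0, hr⟩) (j := c) (by
      rintro rfl
      simp at hc)
    rcases (adj_iff hf).1 hq with ⟨-, h⟩ | ⟨h0, h⟩
    · have : q = p := Fin.ext (h.symm.trans hp)
      rwa [← this]
    · have h1 := hf q h0 q.2
      have h2 := ih (r - q) (by have := q.2; omega) q c h0 h rfl
      omega

theorem link_iff (hf : ∀ j, 0 < j → j < r → f j < j) (hr : 0 < r) (p c : Fin r) :
    ((fatherGraph r f).Adj p c ∧
      (fatherGraph r f).dist ⟨0, hr⟩ p < (fatherGraph r f).dist ⟨0, hr⟩ c) ↔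
      c ≠ ⟨0, hr⟩ ∧ f c = p := by
  have hne : ∀ c : Fin r, c ≠ ⟨0, hr⟩ ↔ 0 < (c : ℕ) := fun c => by
    rw [Ne, Fin.ext_iff]
    simp [Nat.pos_iff_ne_zero]
  rw [hne]
  constructor
  · rintro ⟨h1, h2⟩
    rcases (adj_iff hf).1 h1 with h | h
    · exact h
    · have := dist_lt hf hr p c h.1 h.2
      omega
  · rintro ⟨h1, h2⟩
    exact ⟨(adj_iff hf).2 (Or.inl ⟨h1, h2⟩), dist_lt hf hr c p h1 h2⟩

end fatherGraph

/-! ### Decompositions given by ranks -/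

/-- The data of a decomposition along a ranking of the vertices by `1, …, n`: `X` lists the
vertices by rank, `R` is the rank, and each rank `k ≥ 3` is attached to the pair of the smaller
ranks `lo k < hi k`. -/
structure PairAttachment (n : ℕ) (X R hi lo : ℕ → ℕ) : Prop where
  three_le : 3 ≤ n
  rank : ∀ v < n, 1 ≤ R v ∧ R v ≤ n ∧ X (R v) = v
  vertex : ∀ k, 1 ≤ k → k ≤ n → X k < n ∧ R (X k) = k
  lt : ∀ k, 3 ≤ k → k ≤ n → 1 ≤ lo k ∧ lo k < hi k ∧ hi k < k
  pair : ∀ k, 3 ≤ k → k ≤ n → 3 ≤ hi k → lo k = hi (hi k) ∨ lo k = lo (hi k)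

namespace PairAttachment

variable {n : ℕ} {X R hi lo : ℕ → ℕ}

/-- The vertices with rank in `S`. -/
def withRank (n : ℕ) (R : ℕ → ℕ) (S : Finset ℕ) : Finset (Fin n) :=
  Finset.univ.filter fun v => R v ∈ S

/-- The ranks of the vertices in the bag with index `i`. -/
def rankBag (hi lo : ℕ → ℕ) (i : ℕ) : Finset ℕ := {i + 3, hi (i + 3), lo (i + 3)}

theorem mem_withRank {S : Finset ℕ} {v : Fin n} : v ∈ withRank n R S ↔ R v ∈ S := by
  simp [withRank]

theorem withRank_inter (S T : Finset ℕ) :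
    withRank n R S ∩ withRank n R T = withRank n R (S ∩ T) := by
  ext v
  simp [mem_withRank]

theorem image_withRank (h : PairAttachment n X R hi lo) {S : Finset ℕ}
    (hS : ∀ k ∈ S, 1 ≤ k ∧ k ≤ n) : (withRank n R S).image (fun v : Fin n => (v : ℕ)) = S.image X := by
  ext u
  simp only [Finset.mem_image, mem_withRank]
  constructor
  · rintro ⟨v, hv, rfl⟩
    exact ⟨R v, hv, (h.rank v v.2).2.2⟩
  · rintro ⟨k, hk, rfl⟩
    have := h.vertex k (hS k hk).1 (hS k hk).2
    exact ⟨⟨X k, this.1⟩, by simpa [this.2] using hk, rfl⟩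

theorem image_rank_withRank (h : PairAttachment n X R hi lo) {S : Finset ℕ}
    (hS : ∀ k ∈ S, 1 ≤ k ∧ k ≤ n) : (withRank n R S).image (fun v : Fin n => R v) = S := by
  ext u
  simp only [Finset.mem_image, mem_withRank]
  constructor
  · rintro ⟨v, hv, rfl⟩
    exact hv
  · intro hk
    have := h.vertex u (hS u hk).1 (hS u hk).2
    exact ⟨⟨X u, this.1⟩, by simpa [this.2] using hk, this.2⟩

theorem card_withRank (h : PairAttachment n X R hi lo) {S : Finset ℕ}
    (hS : ∀ k ∈ S, 1 ≤ k ∧ k ≤ n) : (withRank n R S).card = S.card := by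
  rw [← h.image_rank_withRank hS, Finset.card_image_of_injOn]
  · rw [h.image_rank_withRank hS]
  · intro u _ v _ huv
    simp only at huv
    rw [Fin.ext_iff, ← (h.rank u u.2).2.2, huv, (h.rank v v.2).2.2]

theorem mem_rankBag {i k : ℕ} :
    k ∈ rankBag hi lo i ↔ k = i + 3 ∨ k = hi (i + 3) ∨ k = lo (i + 3) := by
  simp [rankBag]

theorem rankBag_bounds (h : PairAttachment n X R hi lo) {i : ℕ} (hi' : i < n - 2) :
    ∀ k ∈ rankBag hi lo i, 1 ≤ k ∧ k ≤ n := by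
  intro k hk
  have := h.lt (i + 3) (by omega) (by omega)
  rcases mem_rankBag.1 hk with rfl | rfl | rfl <;> omega

theorem father_lt (h : PairAttachment n X R hi lo) :
    ∀ j, 0 < j → j < n - 2 → hi (j + 3) - 3 < j := by
  intro j h0 hj
  have := h.lt (j + 3) (by omega) (by omega)
  omega

/-- If `hi ≥ 3`, the bag with index `hi - 3` consists of `hi` and its own pair, which contains `lo`.
Otherwise the pair is `{2, 1}`, the truncated subtraction gives index `0`, and the root bag is `{3,
2, 1}`. -/
theorem pair_mem_father (h : PairAttachment n X R hi lo) {j : ℕ} (hj : j < n - 2) :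
    hi (j + 3) ∈ rankBag hi lo (hi (j + 3) - 3) ∧ lo (j + 3) ∈ rankBag hi lo (hi (j + 3) - 3) := by
  have h1 := h.lt (j + 3) (by omega) (by omega)
  rw [mem_rankBag, mem_rankBag]
  by_cases h3 : 3 ≤ hi (j + 3)
  · have h2 := h.pair (j + 3) (by omega) (by omega) h3
    rw [Nat.sub_add_cancel h3]
    tauto
  · have h0 := h.lt 3 le_rfl h.three_le
    rw [Nat.sub_eq_zero_of_le (by omega), zero_add]
    omega

/-- The ranks in the father bag are all smaller than `j + 3`, so only the attached pair can be
common to both bags. -/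
theorem inter_father (h : PairAttachment n X R hi lo) {j : ℕ} (h0 : 0 < j) (hj : j < n - 2) :
    rankBag hi lo (hi (j + 3) - 3) ∩ rankBag hi lo j = {hi (j + 3), lo (j + 3)} := by
  have h1 := h.pair_mem_father hj
  have hf := h.father_lt j h0 hj
  have h2 := h.lt (hi (j + 3) - 3 + 3) (by omega) (by omega)
  ext k
  rw [Finset.mem_inter]
  simp only [Finset.mem_insert, Finset.mem_singleton]
  constructor
  · rintro ⟨h3, h4⟩
    rw [mem_rankBag] at h3 h4
    omega
  · rintro (rfl | rfl)
    · exact ⟨h1.1, mem_rankBag.2 (by simp)⟩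
    · exact ⟨h1.2, mem_rankBag.2 (by simp)⟩

/-- The nodes containing a vertex of rank `k` form a subtree topped by index `k - 3`: every other
such node has the vertex in its attached pair, hence so does its father have it in its bag. Labels
are exactly the attached pairs, and the larger rank of a pair determines the father. -/
theorem exists_decomposition (h : PairAttachment n X R hi lo) (G : SimpleGraph (Fin n))
    (hG : ∀ u v, G.Adj u v → R v < R u → 3 ≤ R u → R v = hi (R u) ∨ R v = lo (R u)) :
    ∃ T : RootedTreeDecomposition G (Fin (n - 2)), (T.root : ℕ) = 0 ∧
      (∀ i : Fin (n - 2), (T.bag i).image (fun v : Fin n => (v : ℕ)) =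
        {X (i + 3), X (hi (i + 3)), X (lo (i + 3))}) ∧
      (∀ p c, T.IsLink p c ↔ c ≠ T.root ∧ hi (c + 3) - 3 = p) ∧
      T.IsSmooth ∧ T.HasCommonFathers := by
  have hn := h.three_le
  have hr : 0 < n - 2 := by omega
  let f : ℕ → ℕ := fun j => hi (j + 3) - 3
  have hf : ∀ j, 0 < j → j < n - 2 → f j < j := h.father_lt
  have h0 := h.lt 3 le_rfl hn
  have hedge : ∀ u v : Fin n, G.Adj u v → R v < R u →
      ∃ i : Fin (n - 2), R u ∈ rankBag hi lo i ∧ R v ∈ rankBag hi lo i := by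
    intro u v huv hlt
    have hu := h.rank u u.2
    have hv := h.rank v v.2
    by_cases h3 : 3 ≤ R u
    · refine ⟨⟨R u - 3, by omega⟩, ?_⟩
      have := hG u v huv hlt h3
      simp only [mem_rankBag, Nat.sub_add_cancel h3]
      tauto
    · refine ⟨⟨0, hr⟩, ?_⟩
      simp only [mem_rankBag, zero_add]
      omega
  let T : RootedTreeDecomposition G (Fin (n - 2)) :=
    { tree := fatherGraph (n - 2) f
      isTree := fatherGraph.isTree hf hr
      bag := fun i => withRank n R (rankBag hi lo i)
      root := ⟨0, hr⟩
      cover_vertex := by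
        intro v
        have hv := h.rank v v.2
        by_cases h3 : 3 ≤ R v
        · refine ⟨⟨R v - 3, by omega⟩, ?_⟩
          simp only [mem_withRank, mem_rankBag, Nat.sub_add_cancel h3, true_or]
        · refine ⟨⟨0, hr⟩, ?_⟩
          simp only [mem_withRank, mem_rankBag, zero_add]
          omega
      cover_edge := by
        intro u v huv
        simp only [mem_withRank]
        rcases lt_trichotomy (R u) (R v) with hlt | heq | hlt
        · obtain ⟨i, h1, h2⟩ := hedge v u huv.symm hlt
          exact ⟨i, h2, h1⟩
        · refine absurd (Fin.ext ?_) huv.ne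
          rw [← (h.rank u u.2).2.2, heq, (h.rank v v.2).2.2]
        · exact hedge u v huv hlt
      subtree := by
        intro v
        let S : Set (Fin (n - 2)) := {i | v ∈ withRank n R (rankBag hi lo i)}
        have hv := h.rank v v.2
        have hmem : ∀ i : Fin (n - 2), i ∈ S ↔ R v ∈ rankBag hi lo i := fun i => mem_withRank
        -- Ranks `1` and `2` truncate to the root index, which is right because the root bag
        -- contains both.
        have ht : R v - 3 < n - 2 := by omega
        have htop : (⟨R v - 3, ht⟩ : Fin (n - 2)) ∈ S := by
          rw [hmem, mem_rankBag]
          by_cases h3 : 3 ≤ R v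
          · simp only [Nat.sub_add_cancel h3, true_or]
          · simp only [Nat.sub_eq_zero_of_le (le_of_not_ge h3), zero_add]
            omega
        have hreach : ∀ k (hk : k < n - 2) (hkS : (⟨k, hk⟩ : Fin (n - 2)) ∈ S),
            ((fatherGraph (n - 2) f).induce S).Reachable ⟨⟨k, hk⟩, hkS⟩ ⟨⟨R v - 3, ht⟩, htop⟩ := by
          intro k
          induction k using Nat.strong_induction_on with
          | _ k ih =>
            intro hk hkS
            have hlt := h.lt (k + 3) (by omega) (by omega)
            have hkS' := (mem_rankBag.1 ((hmem _).1 hkS))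
            simp only at hkS'
            by_cases hek : k = R v - 3
            · subst hek
              exact SimpleGraph.Reachable.refl _
            · have hk0 : 0 < k := by omega
              have hfk := hf k hk0 hk
              have hfS : (⟨f k, hfk.trans hk⟩ : Fin (n - 2)) ∈ S := by
                rw [hmem]
                have hp := h.pair_mem_father hk
                rcases hkS' with h1 | h1 | h1
                · omega
                · rw [h1]
                  exact hp.1
                · rw [h1]
                  exact hp.2
              have hadj : ((fatherGraph (n - 2) f).induce S).Adj ⟨⟨k, hk⟩, hkS⟩
                  ⟨⟨f k, hfk.trans hk⟩, hfS⟩ :=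
                (fatherGraph.adj_iff hf).2 (Or.inr ⟨hk0, rfl⟩)
              exact hadj.reachable.trans (ih _ hfk _ hfS)
        intro i j
        exact (hreach i.1 i.1.2 i.2).trans (hreach j.1 j.1.2 j.2).symm }
  have hlink : ∀ p c, T.IsLink p c ↔ c ≠ T.root ∧ f c = p := fatherGraph.link_iff hf hr
  have hpos : ∀ c : Fin (n - 2), c ≠ T.root → 0 < (c : ℕ) := fun c hc => by
    by_contra hcon
    exact hc (Fin.ext (by simpa [T] using hcon))
  have hlabel : ∀ p c, T.IsLink p c →
      T.label p c = withRank n R {hi ((c : ℕ) + 3), lo ((c : ℕ) + 3)} := by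
    intro p c hpc
    obtain ⟨h1, h2⟩ := (hlink p c).1 hpc
    rw [← h.inter_father (hpos c h1) c.2, ← withRank_inter]
    change _ ∩ _ = _
    simp only [T, ← h2, f]
  have hpb : ∀ c : Fin (n - 2), ∀ k ∈ ({hi ((c : ℕ) + 3), lo ((c : ℕ) + 3)} : Finset ℕ),
      1 ≤ k ∧ k ≤ n := by
    intro c k hk
    have := h.lt (c + 3) (by omega) (by omega)
    simp only [Finset.mem_insert, Finset.mem_singleton] at hk
    omega
  have hadj : ∀ p c, T.IsLink p c → (T.bag p ∩ T.bag c).card = 2 := by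
    intro p c hpc
    have := h.lt (c + 3) (by omega) (by omega)
    have h1 := hlabel p c hpc
    rw [RootedTreeDecomposition.label] at h1
    rw [h1, h.card_withRank (hpb c), Finset.card_pair (by omega)]
  refine ⟨T, rfl, ?_, hlink, ⟨?_, ?_⟩, ?_⟩
  · intro i
    exact (h.image_withRank (h.rankBag_bounds i.2)).trans (by simp [rankBag])
  · intro i
    have := h.lt (i + 3) (by omega) (by omega)
    refine (h.card_withRank (h.rankBag_bounds i.2)).trans ?_
    exact Finset.card_eq_three.2 ⟨_, _, _, by omega, by omega, by omega, rfl⟩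
  · intro i j hij
    rcases (fatherGraph.adj_iff hf).1 hij with ⟨h1, h2⟩ | ⟨h1, h2⟩
    · exact hadj i j ((hlink i j).2 ⟨fun hc => by simp [hc, T] at h1, h2⟩)
    · rw [Finset.inter_comm]
      exact hadj j i ((hlink j i).2 ⟨fun hc => by simp [hc, T] at h1, h2⟩)
  · intro p₁ c₁ p₂ c₂ hl₁ hl₂ heq
    rw [hlabel _ _ hl₁, hlabel _ _ hl₂] at heq
    -- Passing from vertices back to ranks turns equal labels into equal pairs; `lo < hi` then
    -- identifies the larger elements.
    have h1 := congrArg (fun S => S.image fun v : Fin n => R v) heq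
    simp only [h.image_rank_withRank (hpb _)] at h1
    have hhi : hi ((c₁ : ℕ) + 3) = hi ((c₂ : ℕ) + 3) := by
      have l₁ := h.lt (c₁ + 3) (by omega) (by omega)
      have l₂ := h.lt (c₂ + 3) (by omega) (by omega)
      have m₁ : hi ((c₁ : ℕ) + 3) ∈ ({hi ((c₂ : ℕ) + 3), lo ((c₂ : ℕ) + 3)} : Finset ℕ) := by
        rw [← h1]
        simp
      have m₂ : hi ((c₂ : ℕ) + 3) ∈ ({hi ((c₁ : ℕ) + 3), lo ((c₁ : ℕ) + 3)} : Finset ℕ) := by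
        rw [h1]
        simp
      simp only [Finset.mem_insert, Finset.mem_singleton] at m₁ m₂
      omega
    refine Fin.ext ?_
    rw [← ((hlink _ _).1 hl₁).2, ← ((hlink _ _).1 hl₂).2]
    simp only [f, hhi]

end PairAttachment

/-! ### Reasoning about programs -/

namespace RAM

@[simp] theorem State.reg_setReg (s : State) (x v y : ℕ) :
    (s.setReg x v).reg y = if y = x then v else s.reg y := Function.update_apply ..

@[simp] theorem State.arr_setReg (s : State) (x v : ℕ) : (s.setReg x v).arr = s.arr := rfl

@[simp] theorem State.reg_setArr (s : State) (A i v : ℕ) : (s.setArr A i v).reg = s.reg := rfl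

@[simp] theorem State.arr_setArr (s : State) (A i v B : ℕ) :
    (s.setArr A i v).arr B = if B = A then Function.update (s.arr A) i v else s.arr B :=
  Function.update_apply ..

namespace Program

/-- The sequential composition of a list of programs. -/
def block : List Program → Program
  | [] => nop
  | p :: l => seq p (block l)

/-- `Runs W p s k Q`: started in `s` with time credit `k`, the program `p` halts in a state `s'`
with remaining credit `k'` such that `Q k' s'`. -/
def Runs (W : ℕ) (p : Program) (s : State) (k : ℕ) (Q : ℕ → State → Prop) : Prop :=
  ∃ t s' k', Exec W p s t s' ∧ t + k' ≤ k ∧ Q k' s'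

variable {W k : ℕ} {p q : Program} {l : List Program} {s : State} {Q Q' : ℕ → State → Prop}

theorem Runs.mono (h : Runs W p s k Q) (hQ : ∀ k' s', k' ≤ k → Q k' s' → Q' k' s') :
    Runs W p s k Q' := by
  obtain ⟨t, s', k', h1, h2, h3⟩ := h
  exact ⟨t, s', k', h1, h2, hQ k' s' (by omega) h3⟩

theorem runs_cons (h : Runs W p s k fun k' s' => Runs W (block l) s' k' Q) :
    Runs W (block (p :: l)) s k Q := by
  obtain ⟨t, s', k', h1, h2, t', s'', k'', h3, h4, h5⟩ := h
  exact ⟨_, s'', k'', h1.seq h3, by omega, h5⟩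

theorem runs_nop (hk : 1 ≤ k) (h : Q (k - 1) s) : Runs W nop s k Q :=
  ⟨1, s, k - 1, Exec.nop s, by omega, h⟩

theorem runs_nil (hk : 1 ≤ k) (h : Q (k - 1) s) : Runs W (block []) s k Q :=
  runs_nop hk h

theorem runs_const {x c : ℕ} (hk : 1 ≤ k) (hc : c ≤ W)
    (h : Runs W (block l) (s.setReg x c) (k - 1) Q) : Runs W (block (const x c :: l)) s k Q :=
  runs_cons ⟨1, _, k - 1, Exec.const s x c hc, by omega, h⟩

theorem runs_move {x y : ℕ} (hk : 1 ≤ k)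
    (h : Runs W (block l) (s.setReg x (s.reg y)) (k - 1) Q) :
    Runs W (block (move x y :: l)) s k Q :=
  runs_cons ⟨1, _, k - 1, Exec.move s x y, by omega, h⟩

theorem runs_plus {x y z : ℕ} (hk : 1 ≤ k) (hc : s.reg y + s.reg z ≤ W)
    (h : Runs W (block l) (s.setReg x (s.reg y + s.reg z)) (k - 1) Q) :
    Runs W (block (plus x y z :: l)) s k Q :=
  runs_cons ⟨1, _, k - 1, Exec.plus s x y z hc, by omega, h⟩

theorem runs_minus {x y z : ℕ} (hk : 1 ≤ k)
    (h : Runs W (block l) (s.setReg x (s.reg y - s.reg z)) (k - 1) Q) :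
    Runs W (block (minus x y z :: l)) s k Q :=
  runs_cons ⟨1, _, k - 1, Exec.minus s x y z, by omega, h⟩

theorem runs_load {x A y : ℕ} (hk : 1 ≤ k)
    (h : Runs W (block l) (s.setReg x (s.arr A (s.reg y))) (k - 1) Q) :
    Runs W (block (load x A y :: l)) s k Q :=
  runs_cons ⟨1, _, k - 1, Exec.load s x A y, by omega, h⟩

theorem runs_store {A y x : ℕ} (hk : 1 ≤ k)
    (h : Runs W (block l) (s.setArr A (s.reg y) (s.reg x)) (k - 1) Q) :
    Runs W (block (store A y x :: l)) s k Q :=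
  runs_cons ⟨1, _, k - 1, Exec.store s A y x, by omega, h⟩

theorem runs_branch {b : Test} (hk : 1 ≤ k) (h1 : b.Holds s → Runs W p s (k - 1) Q)
    (h2 : ¬ b.Holds s → Runs W q s (k - 1) Q) : Runs W (branch b p q) s k Q := by
  by_cases hb : b.Holds s
  · obtain ⟨t, s', k', h3, h4, h5⟩ := h1 hb
    exact ⟨_, s', k', Exec.branch_true hb h3, by omega, h5⟩
  · obtain ⟨t, s', k', h3, h4, h5⟩ := h2 hb
    exact ⟨_, s', k', Exec.branch_false hb h3, by omega, h5⟩

theorem runs_loop_true {b : Test} (hb : b.Holds s) (hk : 1 ≤ k)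
    (h : Runs W p s (k - 1) fun k' s' => Runs W (loop b p) s' k' Q) :
    Runs W (loop b p) s k Q := by
  obtain ⟨t, s', k', h1, h2, t', s'', k'', h3, h4, h5⟩ := h
  exact ⟨_, s'', k'', Exec.loop_true hb h1 h3, by omega, h5⟩

theorem runs_loop_false {b : Test} (hb : ¬ b.Holds s) (hk : 1 ≤ k) (h : Q (k - 1) s) :
    Runs W (loop b p) s k Q :=
  ⟨1, s, k - 1, Exec.loop_false hb, by omega, h⟩

/-- The loop rule: the invariant `I` refers to the remaining credit, which decreases. -/
theorem runs_loop {b : Test} (I : ℕ → State → Prop) (hpos : ∀ k s, I k s → 1 ≤ k)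
    (hstep : ∀ k s, I k s → b.Holds s → Runs W p s (k - 1) I) (h : I k s) :
    Runs W (loop b p) s k fun k' s' => I (k' + 1) s' ∧ ¬ b.Holds s' := by
  induction k using Nat.strong_induction_on generalizing s with
  | _ k ih =>
    have hk := hpos k s h
    by_cases hb : b.Holds s
    · refine runs_loop_true hb hk ?_
      obtain ⟨t, s', k', h1, h2, h3⟩ := hstep k s h hb
      exact ⟨t, s', k', h1, h2, ih k' (by omega) h3⟩
    -- The failing test costs one step, so the invariant holds at the final state with one unit more
    -- than the remaining credit.
    · refine runs_loop_false hb hk ⟨?_, hb⟩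
      rwa [Nat.sub_add_cancel hk]

end Program

/-! ### Adjacency lists -/

/-- The cells from `p` on hold the list: `tgt` is the content of a cell and `nxt` the next cell;
`0` is the end of a list, and only cells below `free` are in use. -/
def Cells (tgt nxt : ℕ → ℕ) (free : ℕ) : ℕ → List ℕ → Prop
  | p, [] => p = 0
  | p, w :: l => p ≠ 0 ∧ p < free ∧ tgt p = w ∧ Cells tgt nxt free (nxt p) l

/-- All cells of a list lie below `free`, so writes from `free` on cannot affect it. -/
theorem Cells.frame {tgt nxt tgt' nxt' : ℕ → ℕ} {free free' : ℕ} (hf : free ≤ free')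
    (ht : ∀ c < free, tgt' c = tgt c) (hn : ∀ c < free, nxt' c = nxt c) {p : ℕ} {l : List ℕ}
    (h : Cells tgt nxt free p l) : Cells tgt' nxt' free' p l := by
  induction l generalizing p with
  | nil => exact h
  | cons w l ih =>
    obtain ⟨h1, h2, h3, h4⟩ := h
    refine ⟨h1, by omega, by rw [ht p h2, h3], ?_⟩
    rw [hn p h2]
    exact ih h4

/-- The state represents the adjacency lists `L`: array `4` holds the heads of the lists, arrays
`5` and `6` the contents and the successors of the cells, and register `4` the first free cell. -/
structure Heap (s : State) (L : ℕ → List ℕ) : Prop where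
  free_pos : 1 ≤ s.reg 4
  cells : ∀ v, Cells (s.arr 5) (s.arr 6) (s.reg 4) (s.arr 4 v) (L v)

theorem Heap.congr {s s' : State} {L : ℕ → List ℕ} (h : Heap s L) (h4 : s'.reg 4 = s.reg 4)
    (a4 : s'.arr 4 = s.arr 4) (a5 : s'.arr 5 = s.arr 5) (a6 : s'.arr 6 = s.arr 6) :
    Heap s' L :=
  ⟨h4 ▸ h.free_pos, fun v => by
    rw [h4, a4, a5, a6]
    exact h.cells v⟩

/-- Redirecting the head of a list. -/
theorem Heap.set_head {s s' : State} {L : ℕ → List ℕ} (h : Heap s L) {v c : ℕ} {l : List ℕ}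
    (hc : Cells (s.arr 5) (s.arr 6) (s.reg 4) c l) (h4 : s'.reg 4 = s.reg 4)
    (a4 : s'.arr 4 = Function.update (s.arr 4) v c) (a5 : s'.arr 5 = s.arr 5)
    (a6 : s'.arr 6 = s.arr 6) : Heap s' (Function.update L v l) := by
  refine ⟨h4 ▸ h.free_pos, fun u => ?_⟩
  rw [h4, a4, a5, a6]
  by_cases hu : u = v
  · subst hu
    simpa using hc
  · simpa [hu] using h.cells u

namespace Program

variable {W k : ℕ} {s : State} {Q : ℕ → State → Prop}

/-- Insert the vertex in register `w` into the list of the vertex in register `u`. -/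
def push (u w : ℕ) : Program :=
  block [store 5 4 w, load 13 4 u, store 6 4 13, store 4 u 4, plus 4 4 2]

/-- The effect of inserting `w` into the list of `u`. -/
structure PushPost (s : State) (L : ℕ → List ℕ) (u w : ℕ) (s' : State) : Prop where
  heap : Heap s' (Function.update L u (w :: L u))
  free : s'.reg 4 = s.reg 4 + 1
  reg : ∀ x, x ≠ 4 → x ≠ 13 → s'.reg x = s.reg x
  arr : ∀ A, A ≠ 4 → A ≠ 5 → A ≠ 6 → s'.arr A = s.arr A

/-- The new cell is the first free one, so all old lists survive, and its successor is the old head.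
The cost `6` is five instructions and the closing `nop`; register `13` is scratch, overwritten
before `u` is used as an address for the last time. -/
theorem runs_push {u w : ℕ} {L : ℕ → List ℕ} (hu13 : u ≠ 13) (h : Heap s L)
    (h2 : s.reg 2 = 1) (hW : s.reg 4 + 1 ≤ W) (hk : 6 ≤ k)
    (hQ : ∀ s', PushPost s L (s.reg u) (s.reg w) s' → Q (k - 6) s') :
    Runs W (push u w) s k Q := by
  apply runs_store (by omega)
  apply runs_load (by omega)
  apply runs_store (by omega)
  apply runs_store (by omega)
  apply runs_plus (by omega) (by simp [h2, hW])
  apply runs_nil (by omega)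
  simp only [Nat.sub_sub, Nat.reduceAdd]
  apply hQ
  refine ⟨⟨?_, fun v => ?_⟩, ?_, ?_, ?_⟩
  · simp [h2]
  · have hfr : ∀ {p l}, Cells (s.arr 5) (s.arr 6) (s.reg 4) p l →
        Cells (Function.update (s.arr 5) (s.reg 4) (s.reg w))
          (Function.update (s.arr 6) (s.reg 4) (s.arr 4 (s.reg u))) (s.reg 4 + 1) p l :=
      fun hp => hp.frame (by omega)
        (fun c hc => Function.update_of_ne (by omega) _ _)
        (fun c hc => Function.update_of_ne (by omega) _ _)
    by_cases hv : v = s.reg u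
    · subst hv
      have := h.free_pos
      simpa [hu13, h2, Cells, show s.reg 4 ≠ 0 by omega] using hfr (h.cells (s.reg u))
    · simpa [hu13, h2, hv] using hfr (h.cells v)
  · simp [h2]
  · intro x hx4 hx13
    simp [hx4, hx13]
  · intro A h4 h5 h6
    simp [h4, h5, h6]

/-! ### Scanning a list for distinct neighbours -/

/-- Scan the cells from register `11` on for neighbours of the vertex `v` in register `8` that are
not eliminated. At most two different ones are collected in the registers `9` and `10`, which
hold `v` if there are none and are equal if there is only one. When a third one appears, register
`14` is set, and the list of `v` is replaced by these three followed by the rest of the list. -/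
def scan : Program :=
  loop (.ne 11 3) (block [load 12 5 11, load 11 6 11, load 13 8 12,
    branch (.ne 13 3) nop (branch (.eq 12 8) nop (branch (.eq 12 9) nop (branch (.eq 12 10) nop
      (branch (.eq 9 8) (block [move 9 12, move 10 12])
        (branch (.eq 9 10) (block [move 10 12])
          (block [store 4 8 11, push 8 12, push 8 10, push 8 9, move 11 3, move 14 2]))))))])

/-- The vertices `x` and `y` are the neighbours of `v` collected so far. -/
def Found (R : ℕ → ℕ) (l : List ℕ) (v x y : ℕ) : Prop :=
  (x = v ∧ y = v) ∨ (x ≠ v ∧ y ≠ v ∧ (x ∈ l ∧ R x = 0) ∧ (y ∈ l ∧ R y = 0))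

/-- The scan has met at most two different neighbours. -/
structure ScanLow (s : State) (L : ℕ → List ℕ) (s' : State) : Prop where
  flag : s'.reg 14 = 0
  free : s'.reg 4 = s.reg 4
  heap : Heap s' L
  found : Found (s.arr 8) (L (s.reg 8)) (s.reg 8) (s'.reg 9) (s'.reg 10)
  complete : ∀ w ∈ L (s.reg 8), s.arr 8 w = 0 → w ≠ s.reg 8 → w = s'.reg 9 ∨ w = s'.reg 10

/-- The scan has met three different neighbours; `l` is the new list. -/
structure ScanHigh (s : State) (L : ℕ → List ℕ) (l : List ℕ) (s' : State) : Prop where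
  flag : s'.reg 14 ≠ 0
  free : s'.reg 4 = s.reg 4 + 3
  heap : Heap s' (Function.update L (s.reg 8) l)
  subset : ∀ w ∈ l, w ∈ L (s.reg 8)
  complete : ∀ w ∈ L (s.reg 8), s.arr 8 w = 0 → w ≠ s.reg 8 → w ∈ l
  three : ∃ a b c, a ≠ b ∧ a ≠ c ∧ b ≠ c ∧ ∀ w, w = a ∨ w = b ∨ w = c →
    w ∈ L (s.reg 8) ∧ s.arr 8 w = 0 ∧ w ≠ s.reg 8

/-- The effect of a scan of the list `l` with credit `k`. -/
structure ScanPost (s : State) (L : ℕ → List ℕ) (l : List ℕ) (k k' : ℕ) (s' : State) : Prop where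
  reg : ∀ x, x ≠ 4 → (x < 9 ∨ 14 < x) → s'.reg x = s.reg x
  arr : ∀ A, A ≠ 4 → A ≠ 5 → A ≠ 6 → s'.arr A = s.arr A
  result : (ScanLow s L s' ∧ k ≤ k' + 40 * l.length + 1) ∨
    ∃ l', ScanHigh s L l' s' ∧ k + 40 * l'.length ≤ k' + 40 * l.length + 160

/-- One round reads one cell, changes only scratch registers and costs at most `40`; a postcondition
for the rest of the list thus gives one for the whole list. -/
theorem ScanPost.trans {s s₁ s' : State} {L : ℕ → List ℕ} {l : List ℕ} {w k k₁ k' : ℕ}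
    (h : ScanPost s₁ L l k₁ k' s')
    (hr : ∀ x, (x < 9 ∨ 14 < x) → s₁.reg x = s.reg x) (ha : s₁.arr = s.arr)
    (hk : k ≤ k₁ + 40) : ScanPost s L (w :: l) k k' s' := by
  have h4 := hr 4 (by omega)
  have h8 := hr 8 (by omega)
  refine ⟨fun x hx hx' => (h.reg x hx hx').trans (hr x hx'), fun A a4 a5 a6 => ?_, ?_⟩
  · rw [h.arr A a4 a5 a6, ha]
  · rcases h.result with ⟨hl, hb⟩ | ⟨l', hl, hb⟩
    · refine Or.inl ⟨⟨hl.flag, hl.free.trans h4, hl.heap, ?_, ?_⟩, ?_⟩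
      · simpa [ha, h8] using hl.found
      · simpa [ha, h8] using hl.complete
      · simp only [List.length_cons]
        omega
    · refine Or.inr ⟨l', ⟨hl.flag, by rw [hl.free, h4], ?_, ?_, ?_, ?_⟩, ?_⟩
      · simpa [h8] using hl.heap
      · simpa [h8] using hl.subset
      · simpa [ha, h8] using hl.complete
      · simpa [ha, h8] using hl.three
      · simp only [List.length_cons]
        omega

/-- Every cell read is charged `40`. If a third neighbour appears, the cells read so far leave the
list and pay for their own reading; the surplus `160` covers the three cells put back and the last
round. The hypothesis `hC` says that every neighbour is either collected or still unread. -/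
theorem runs_scan {L : ℕ → List ℕ} (l : List ℕ) (hL : Heap s L) (h2 : s.reg 2 = 1)
    (h3 : s.reg 3 = 0) (h14 : s.reg 14 = 0) (hW : s.reg 4 + 3 ≤ W)
    (hl : Cells (s.arr 5) (s.arr 6) (s.reg 4) (s.reg 11) l)
    (hsub : ∀ w ∈ l, w ∈ L (s.reg 8))
    (hF : Found (s.arr 8) (L (s.reg 8)) (s.reg 8) (s.reg 9) (s.reg 10))
    (hC : ∀ w ∈ L (s.reg 8), s.arr 8 w = 0 → w ≠ s.reg 8 →
      w ∈ l ∨ w = s.reg 9 ∨ w = s.reg 10)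
    (hk : 40 * l.length + 60 ≤ k) : Runs W scan s k (ScanPost s L l k) := by
  induction l generalizing s k with
  | nil =>
    have h11 : s.reg 11 = 0 := hl
    refine runs_loop_false (by simp [Test.Holds, h11, h3]) (by omega) ?_
    refine ⟨fun _ _ _ => rfl, fun _ _ _ _ => rfl, Or.inl ⟨⟨h14, rfl, hL, hF, ?_⟩, by simp; omega⟩⟩
    simpa using hC
  | cons w l ih =>
    simp only [List.length_cons] at hk
    obtain ⟨hp0, hp, htgt, hnxt⟩ := hl
    have hwL := hsub w (by simp)
    have hsub' : ∀ u ∈ l, u ∈ L (s.reg 8) := fun u hu => hsub u (by simp [hu])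
    -- Common continuation of all rounds that go on to the next cell.
    have next : ∀ s₂ k₂, s₂.arr = s.arr → (∀ x, (x < 9 ∨ 14 < x) → s₂.reg x = s.reg x) →
        s₂.reg 14 = 0 → s₂.reg 11 = s.arr 6 (s.reg 11) →
        Found (s.arr 8) (L (s.reg 8)) (s.reg 8) (s₂.reg 9) (s₂.reg 10) →
        (∀ u ∈ L (s.reg 8), s.arr 8 u = 0 → u ≠ s.reg 8 →
          u ∈ l ∨ u = s₂.reg 9 ∨ u = s₂.reg 10) → k ≤ k₂ + 39 →
        Runs W (block []) s₂ k₂ fun k' s' => Runs W scan s' k' (ScanPost s L (w :: l) k) := by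
      intro s₂ k₂ ha hr h14 h11 hF hC hk₂
      refine runs_nil (by omega) ?_
      have r4 := hr 4 (by omega)
      have r8 := hr 8 (by omega)
      refine (ih (k := k₂ - 1) (hL.congr r4 (by rw [ha]) (by rw [ha]) (by rw [ha]))
        ((hr 2 (by omega)).trans h2) ((hr 3 (by omega)).trans h3) h14 (by rw [r4]; exact hW)
        (by rw [ha, r4, h11]; exact hnxt) (by rw [r8]; exact hsub') (by rw [ha, r8]; exact hF)
        (by rw [ha, r8]; exact hC) (by omega)).mono fun k' s' _ hpost => ?_
      exact hpost.trans hr ha (by omega)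
    refine runs_loop_true (by simpa [Test.Holds, h3] using hp0) (by omega) ?_
    apply runs_load (by omega)
    apply runs_load (by omega)
    apply runs_load (by omega)
    apply runs_cons
    simp only [State.arr_setReg, State.reg_setReg, Nat.reduceEqDiff, if_true, if_false, htgt]
    obtain ⟨s₁, hs₁⟩ : ∃ s₁ : State, s₁ = ((s.setReg 12 w).setReg 11
      (s.arr 6 (s.reg 11))).setReg 13 (s.arr 8 w) := ⟨_, rfl⟩
    rw [← hs₁]
    have ha : s₁.arr = s.arr := by simp [hs₁]
    have hr : ∀ x, x ≠ 11 → x ≠ 12 → x ≠ 13 → s₁.reg x = s.reg x := fun x x1 x2 x3 => by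
      simp [hs₁, x1, x2, x3]
    have hr' : ∀ x, (x < 9 ∨ 14 < x) → s₁.reg x = s.reg x := fun x hx =>
      hr x (by omega) (by omega) (by omega)
    have r11 : s₁.reg 11 = s.arr 6 (s.reg 11) := by simp [hs₁]
    have r12 : s₁.reg 12 = w := by simp [hs₁]
    have r13 : s₁.reg 13 = s.arr 8 w := by simp [hs₁]
    have r8 := hr' 8 (by omega)
    have r9 := hr 9 (by omega) (by omega) (by omega)
    have r10 := hr 10 (by omega) (by omega) (by omega)
    have r3 : s₁.reg 3 = 0 := (hr' 3 (by omega)).trans h3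
    have r14 : s₁.reg 14 = 0 := (hr 14 (by omega) (by omega) (by omega)).trans h14
    -- Rounds in which `w` is eliminated, equals the scanned vertex or is already collected.
    have skip : ∀ k₂, (s.arr 8 w = 0 → w ≠ s.reg 8 → w = s.reg 9 ∨ w = s.reg 10) →
        k ≤ k₂ + 38 → Runs W nop s₁ k₂ fun k' s' => Runs W (block []) s' k'
          fun k' s' => Runs W scan s' k' (ScanPost s L (w :: l) k) := by
      intro k₂ hw hk₂
      refine runs_nop (by omega) (next s₁ _ ha hr' r14 r11 (by rw [r9, r10]; exact hF) ?_
        (by omega))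
      intro u hu hu0 huv
      rw [r9, r10]
      rcases hC u hu hu0 huv with h | h
      · rcases List.mem_cons.1 h with rfl | h
        · exact Or.inr (hw hu0 huv)
        · exact Or.inl h
      · exact Or.inr h
    refine runs_branch (by omega) (fun hb => skip _ ?_ (by omega)) fun hw0 => ?_
    · intro h0
      exact absurd h0 (by simpa [Test.Holds, r13, r3] using hb)
    replace hw0 : s.arr 8 w = 0 := by simpa [Test.Holds, r13, r3] using hw0
    refine runs_branch (by omega) (fun hb => skip _ ?_ (by omega)) fun hwv => ?_
    · intro _ h0
      exact absurd (by simpa [Test.Holds, r12, r8] using hb) h0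
    replace hwv : w ≠ s.reg 8 := by simpa [Test.Holds, r12, r8] using hwv
    refine runs_branch (by omega) (fun hb => skip _ ?_ (by omega)) fun hwx => ?_
    · intro _ _
      exact Or.inl (by simpa [Test.Holds, r12, r9] using hb)
    replace hwx : w ≠ s.reg 9 := by simpa [Test.Holds, r12, r9] using hwx
    refine runs_branch (by omega) (fun hb => skip _ ?_ (by omega)) fun hwy => ?_
    · intro _ _
      exact Or.inr (by simpa [Test.Holds, r12, r10] using hb)
    replace hwy : w ≠ s.reg 10 := by simpa [Test.Holds, r12, r10] using hwy
    refine runs_branch (by omega) (fun hxv => ?_) fun hxv => ?_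
    · -- the first neighbour
      replace hxv : s.reg 9 = s.reg 8 := by simpa [Test.Holds, r9, r8] using hxv
      have hyv : s.reg 10 = s.reg 8 := by
        rcases hF with h | h
        · exact h.2
        · exact absurd hxv h.1
      apply runs_move (by omega)
      apply runs_move (by omega)
      apply runs_nil (by omega)
      refine next _ _ (by simp [ha]) ?_ (by simpa using r14) (by simpa using r11) ?_ ?_ (by omega)
      · intro x hx
        simp [hr' x hx, show x ≠ 9 by omega, show x ≠ 10 by omega]
      · have hF' : Found (s.arr 8) (L (s.reg 8)) (s.reg 8) w w :=
          Or.inr ⟨hwv, hwv, ⟨hwL, hw0⟩, hwL, hw0⟩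
        simpa [r12] using hF'
      · intro u hu hu0 huv
        have := hC u hu hu0 huv
        simp only [List.mem_cons, hxv, hyv] at this
        simp [r12]
        tauto
    replace hxv : s.reg 9 ≠ s.reg 8 := by simpa [Test.Holds, r9, r8] using hxv
    obtain ⟨-, hyv, hx, hy⟩ : s.reg 9 ≠ s.reg 8 ∧ s.reg 10 ≠ s.reg 8 ∧
        (s.reg 9 ∈ L (s.reg 8) ∧ s.arr 8 (s.reg 9) = 0) ∧
        (s.reg 10 ∈ L (s.reg 8) ∧ s.arr 8 (s.reg 10) = 0) := by
      rcases hF with h | h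
      · exact absurd h.1 hxv
      · exact h
    refine runs_branch (by omega) (fun hxy => ?_) fun hxy => ?_
    · -- the second neighbour
      replace hxy : s.reg 9 = s.reg 10 := by simpa [Test.Holds, r9, r10] using hxy
      apply runs_move (by omega)
      apply runs_nil (by omega)
      refine next _ _ (by simp [ha]) ?_ (by simpa using r14) (by simpa using r11) ?_ ?_ (by omega)
      · intro x hx
        simp [hr' x hx, show x ≠ 10 by omega]
      · have hF' : Found (s.arr 8) (L (s.reg 8)) (s.reg 8) (s.reg 9) w :=
          Or.inr ⟨hxv, hwv, hx, hwL, hw0⟩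
        simpa [r12, r9] using hF'
      · intro u hu hu0 huv
        have := hC u hu hu0 huv
        simp only [List.mem_cons, ← hxy] at this
        simp [r12, r9]
        tauto
    -- the third neighbour
    replace hxy : s.reg 9 ≠ s.reg 10 := by simpa [Test.Holds, r9, r10] using hxy
    have r2 : s₁.reg 2 = 1 := (hr' 2 (by omega)).trans h2
    have r4 := hr' 4 (by omega)
    apply runs_store (by omega)
    -- First the list is cut down to its unread rest; the three pushes then restore the collected
    -- neighbours, so none is lost.
    have hH : Heap (s₁.setArr 4 (s₁.reg 8) (s₁.reg 11)) (Function.update L (s.reg 8) l) :=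
      hL.set_head hnxt (by simpa using r4) (by simp [r8, r11, ha]) (by simp [ha]) (by simp [ha])
    refine runs_cons (runs_push (by omega) hH (by simpa using r2)
      (by simp [r4]; omega) (by omega) fun s₂ P₂ => ?_)
    refine runs_cons (runs_push (by omega) P₂.heap
      (by rw [P₂.reg 2 (by omega) (by omega)]; simpa using r2)
      (by rw [P₂.free]; simp [r4]; omega) (by omega) fun s₃ P₃ => ?_)
    refine runs_cons (runs_push (by omega) P₃.heap
      (by rw [P₃.reg 2 (by omega) (by omega), P₂.reg 2 (by omega) (by omega)]; simpa using r2)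
      (by rw [P₃.free, P₂.free]; simp [r4]; omega) (by omega) fun s₄ P₄ => ?_)
    apply runs_move (by omega)
    apply runs_move (by omega)
    apply runs_nil (by omega)
    apply runs_nil (by omega)
    have hreg : ∀ x, x ≠ 4 → x ≠ 13 → s₄.reg x = s₁.reg x := fun x x4 x13 => by
      rw [P₄.reg x x4 x13, P₃.reg x x4 x13, P₂.reg x x4 x13, State.reg_setArr]
    have harr : ∀ A, A ≠ 4 → A ≠ 5 → A ≠ 6 → s₄.arr A = s.arr A := fun A x4 x5 x6 => by
      rw [P₄.arr A x4 x5 x6, P₃.arr A x4 x5 x6, P₂.arr A x4 x5 x6, State.arr_setArr, if_neg x4, ha]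
    have hfree : s₄.reg 4 = s.reg 4 + 3 := by
      rw [P₄.free, P₃.free, P₂.free, State.reg_setArr, r4]
    have hheap := P₄.heap
    rw [P₃.reg 8 (by omega) (by omega), P₃.reg 9 (by omega) (by omega),
      P₂.reg 8 (by omega) (by omega), P₂.reg 9 (by omega) (by omega),
      P₂.reg 10 (by omega) (by omega)] at hheap
    simp only [State.reg_setArr, r8, r9, r10, r12, Function.update_self, Function.update_idem]
      at hheap
    refine runs_loop_false ?_ (by omega) ?_
    · simp [Test.Holds]
    refine ⟨?_, ?_, Or.inr ⟨s.reg 9 :: s.reg 10 :: w :: l, ⟨?_, ?_, ?_, ?_, ?_, ?_⟩, ?_⟩⟩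
    · intro x x4 hx
      simp [show x ≠ 11 by omega, show x ≠ 14 by omega]
      rw [hreg x x4 (by omega), hr' x hx]
    · simpa using harr
    · simp [hreg 2, r2]
    · simpa using hfree
    · exact hheap.congr (by simp) (by simp) (by simp) (by simp)
    · intro u hu
      simp only [List.mem_cons] at hu
      rcases hu with rfl | rfl | rfl | hu
      exacts [hx.1, hy.1, hwL, hsub' u hu]
    · intro u hu hu0 huv
      have := hC u hu hu0 huv
      simp only [List.mem_cons] at this ⊢
      tauto
    · refine ⟨s.reg 9, s.reg 10, w, hxy, hwx.symm, hwy.symm, ?_⟩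
      rintro u (rfl | rfl | rfl)
      exacts [⟨hx.1, hx.2, hxv⟩, ⟨hy.1, hy.2, hyv⟩, ⟨hwL, hw0, hwv⟩]
    · simp only [List.length_cons]
      omega

end Program
end RAM

/-! ### Elimination of vertices with at most two neighbours -/

open RAM RAM.Program

/-- The pair `x`, `y` is present in the adjacency lists, or one of the two vertices has been
eliminated before the other one and the other one is recorded as its neighbour. -/
def Recorded (R A B : ℕ → ℕ) (L : ℕ → List ℕ) (x y : ℕ) : Prop :=
  (R x = 0 ∧ R y = 0 ∧ y ∈ L x ∧ x ∈ L y) ∨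
    (R y < R x ∧ (y = A (R x) ∨ y = B (R x))) ∨ (R x < R y ∧ (x = A (R y) ∨ x = B (R y)))

/-- The vertex `u` has at most two neighbours that are not eliminated. -/
def Low (R : ℕ → ℕ) (L : ℕ → List ℕ) (u : ℕ) : Prop :=
  ∃ x y, ∀ w ∈ L u, R w = 0 → w ≠ u → w = x ∨ w = y

/-- A partial elimination of the graph with adjacency relation `E` on `{0, …, n - 1}`: the
eliminated vertices have ranks `n, n - 1, …, c + 1`, and the rank of the others is `0`; `X k` is
the vertex with rank `k`, and `A k`, `B k` are its neighbours at the time of its elimination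
(or `X k` itself if there is none). -/
structure Elimination (n : ℕ) (E : ℕ → ℕ → Prop) (R X A B : ℕ → ℕ) (c : ℕ)
    (L : ℕ → List ℕ) : Prop where
  mem_lt : ∀ u w, w ∈ L u → w < n
  symm : ∀ u w, R u = 0 → R w = 0 → w ∈ L u → u ∈ L w
  width : HasWidthTwo fun u w => u ≠ w ∧ R u = 0 ∧ R w = 0 ∧ w ∈ L u
  card : ((Finset.range n).filter fun u => R u = 0).card = c
  rank : ∀ v, R v ≠ 0 → v < n ∧ c < R v ∧ R v ≤ n ∧ X (R v) = v
  vertex : ∀ k, c < k → k ≤ n → X k < n ∧ R (X k) = k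
  attach : ∀ k, c < k → k ≤ n → A k < n ∧ B k < n ∧ ((A k = X k ∧ B k = X k) ∨
    (R (A k) < k ∧ R (B k) < k ∧ (A k = B k ∨ Recorded R A B L (A k) (B k))))
  edge : ∀ u w, E u w → u ≠ w ∧ Recorded R A B L u w

namespace Elimination

variable {n c : ℕ} {E : ℕ → ℕ → Prop} {R X A B : ℕ → ℕ} {L L' : ℕ → List ℕ}

theorem pos (h : Elimination n E R X A B c L) {v : ℕ} (hv : v < n) (hR : R v = 0) : 0 < c := by
  rw [← h.card]
  exact Finset.card_pos.2 ⟨v, by simp [hv, hR]⟩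

theorem le (h : Elimination n E R X A B c L) : c ≤ n := by
  rw [← h.card]
  exact (Finset.card_filter_le _ _).trans (by simp)

/-- Shortening a list without losing neighbours. -/
theorem shorten (h : Elimination n E R X A B c L) {v : ℕ} {l : List ℕ} (hv : R v = 0)
    (hsub : ∀ w ∈ l, w ∈ L v) (hcomp : ∀ w ∈ L v, R w = 0 → w ≠ v → w ∈ l) :
    Elimination n E R X A B c (Function.update L v l) := by
  have hmem : ∀ u w, w ∈ Function.update L v l u → w ∈ L u := by
    intro u w hw
    by_cases hu : u = v
    · subst hu
      exact hsub w (by simpa using hw)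
    · simpa [hu] using hw
  have hmem' : ∀ u w, w ≠ u → R w = 0 → w ∈ L u → w ∈ Function.update L v l u := by
    intro u w hne hw0 hw
    by_cases hu : u = v
    · subst hu
      simpa using hcomp w hw hw0 hne
    · simpa [hu] using hw
  have hrec : ∀ x y, x ≠ y → Recorded R A B L x y →
      Recorded R A B (Function.update L v l) x y := by
    rintro x y hxy (⟨h1, h2, h3, h4⟩ | h1)
    · exact Or.inl ⟨h1, h2, hmem' x y hxy.symm h2 h3, hmem' y x hxy h1 h4⟩
    · exact Or.inr h1
  refine ⟨fun u w hw => h.mem_lt u w (hmem u w hw), fun u w hu hw huw => ?_,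
    h.width.mono fun u w huw => ⟨huw.1, huw.2.1, huw.2.2.1, hmem u w huw.2.2.2⟩, h.card, h.rank,
    h.vertex, fun k h1 h2 => ?_, fun u w huw => ⟨(h.edge u w huw).1, ?_⟩⟩
  · by_cases hne : u = w
    · subst hne
      exact huw
    · exact hmem' w u hne hu (h.symm u w hu hw (hmem u w huw))
  · obtain ⟨hA, hB, hAB⟩ := h.attach k h1 h2
    refine ⟨hA, hB, hAB.imp_right fun ⟨h3, h4, h5⟩ => ⟨h3, h4, ?_⟩⟩
    by_cases hne : A k = B k
    · exact Or.inl hne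
    · exact Or.inr (hrec _ _ hne (h5.resolve_left hne))
  · exact hrec u w (h.edge u w huw).1 (h.edge u w huw).2

/-- The elimination of the vertex `v` with neighbours `x` and `y`. -/
theorem step (h : Elimination n E R X A B c L) {v x y : ℕ} (hv : v < n) (hR : R v = 0)
    (hF : Found R (L v) v x y)
    (hcomp : ∀ w ∈ L v, R w = 0 → w ≠ v → w = x ∨ w = y)
    (hL : ∀ u w, u ≠ v → (w ∈ L' u ↔ w ∈ L u ∨ (u = x ∧ w = y) ∨ (u = y ∧ w = x)))
    (hLv : ∀ w ∈ L' v, w = x ∨ w = y) :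
    Elimination n E (Function.update R v c) (Function.update X c v) (Function.update A c x)
      (Function.update B c y) (c - 1) L' := by
  have hc := h.pos hv hR
  have hcn := h.le
  have hxn : x < n := by
    rcases hF with hF | hF
    · rw [hF.1]
      exact hv
    · exact h.mem_lt v x hF.2.2.1.1
  have hyn : y < n := by
    rcases hF with hF | hF
    · rw [hF.2]
      exact hv
    · exact h.mem_lt v y hF.2.2.2.1
  have hRv : Function.update R v c v = c := Function.update_self ..
  have hRo : ∀ u, u ≠ v → Function.update R v c u = R u := fun u hu =>
    Function.update_of_ne hu _ _
  have halive : ∀ u, Function.update R v c u = 0 ↔ u ≠ v ∧ R u = 0 := by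
    intro u
    by_cases hu : u = v
    · subst hu
      simp [hc.ne']
    · simp [hu]
  have hrec : ∀ p q, p ≠ q → Recorded R A B L p q → Recorded (Function.update R v c)
      (Function.update A c x) (Function.update B c y) L' p q := by
    -- A pair recorded earlier sits at a rank above `c`, so updates at index `c` miss it. If the
    -- smaller vertex is `v`, its rank rises from `0` to `c`, which is still smaller.
    have aux : ∀ p q, R q < R p → (q = A (R p) ∨ q = B (R p)) →
        Function.update R v c q < Function.update R v c p ∧
          (q = Function.update A c x (Function.update R v c p) ∨
            q = Function.update B c y (Function.update R v c p)) := by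
      intro p q hlt hq
      have hp := h.rank p (by omega)
      have hpv : p ≠ v := by
        rintro rfl
        omega
      have hpc : R p ≠ c := by omega
      rw [hRo p hpv, Function.update_of_ne hpc, Function.update_of_ne hpc]
      refine ⟨?_, hq⟩
      by_cases hqv : q = v
      · rw [hqv, hRv]
        exact hp.2.1
      · rwa [hRo q hqv]
    rintro p q hpq (⟨h1, h2, h3, h4⟩ | ⟨h1, h2⟩ | ⟨h1, h2⟩)
    · by_cases hpv : p = v
      · subst hpv
        refine Or.inr (Or.inl ?_)
        rw [hRv, hRo q hpq.symm, Function.update_self, Function.update_self]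
        exact ⟨by omega, hcomp q h3 h2 hpq.symm⟩
      by_cases hqv : q = v
      · subst hqv
        refine Or.inr (Or.inr ?_)
        rw [hRv, hRo p hpq, Function.update_self, Function.update_self]
        exact ⟨by omega, hcomp p h4 h1 hpq⟩
      · refine Or.inl ⟨(halive p).2 ⟨hpv, h1⟩, (halive q).2 ⟨hqv, h2⟩, ?_, ?_⟩
        · exact (hL p q hpv).2 (Or.inl h3)
        · exact (hL q p hqv).2 (Or.inl h4)
    · exact Or.inr (Or.inl (aux p q h1 h2))
    · exact Or.inr (Or.inr (aux q p h1 h2))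
  refine ⟨?_, ?_, ?_, ?_, ?_, ?_, ?_, fun u w huw =>
    ⟨(h.edge u w huw).1, hrec u w (h.edge u w huw).1 (h.edge u w huw).2⟩⟩
  · intro u w hw
    by_cases hu : u = v
    · subst hu
      rcases hLv w hw with rfl | rfl <;> assumption
    · rcases (hL u w hu).1 hw with hw | ⟨-, rfl⟩ | ⟨-, rfl⟩
      exacts [h.mem_lt u w hw, hyn, hxn]
  · intro u w hu hw huw
    rw [halive] at hu hw
    rw [hL w u hw.1]
    rcases (hL u w hu.1).1 huw with huw | huw | huw
    · exact Or.inl (h.symm u w hu.2 hw.2 huw)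
    · exact Or.inr (Or.inr huw.symm)
    · exact Or.inr (Or.inl huw.symm)
  · simp only [halive]
    -- Without neighbours the step is a deletion. Otherwise it contracts the edge between `v` and
    -- `x`, which turns the edge from `v` to `y` into the new edge from `x` to `y`; for `x = y` the
    -- new entry is a loop and does not count.
    rcases hF with hF | hF
    · refine h.width.mono fun u w ⟨h1, h2, h3, h4⟩ => ⟨h1, h2.2, h3.2, ?_⟩
      rcases (hL u w h2.1).1 h4 with h5 | h5 | h5
      · exact h5
      · exact absurd (h5.1.trans hF.1) h2.1
      · exact absurd (h5.1.trans hF.2) h2.1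
    · obtain ⟨hxv, hyv, ⟨hx, hx0⟩, hy, hy0⟩ := hF
      refine h.width.contract (v := v) (x := x) ⟨hxv.symm, hR, hx0, hx⟩ hxv.symm ?_
      rintro u w ⟨h1, h2, h3, h4⟩
      refine ⟨h2.1, h3.1, ?_⟩
      rcases (hL u w h2.1).1 h4 with h5 | ⟨rfl, rfl⟩ | ⟨rfl, rfl⟩
      · exact Or.inl ⟨h1, h2.2, h3.2, h5⟩
      · exact Or.inr (Or.inl ⟨rfl, hyv.symm, hR, hy0, hy⟩)
      · exact Or.inr (Or.inr ⟨rfl, hyv.symm, hR, hy0, hy⟩)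
  · have hset : ((Finset.range n).filter fun u => Function.update R v c u = 0) =
        ((Finset.range n).filter fun u => R u = 0).erase v := by
      ext u
      simp only [Finset.mem_filter, Finset.mem_erase, halive]
      tauto
    rw [hset, Finset.card_erase_of_mem (by simp [hv, hR]), h.card]
  · intro u hu
    by_cases huv : u = v
    · subst huv
      rw [hRv, Function.update_self]
      exact ⟨hv, by omega, hcn, rfl⟩
    · rw [hRo u huv] at hu ⊢
      obtain ⟨h1, h2, h3, h4⟩ := h.rank u hu
      refine ⟨h1, by omega, h3, ?_⟩
      rwa [Function.update_of_ne (by omega)]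
  · intro k h1 h2
    by_cases hk : k = c
    · subst hk
      rw [Function.update_self, hRv]
      exact ⟨hv, rfl⟩
    · obtain ⟨h3, h4⟩ := h.vertex k (by omega) h2
      rw [Function.update_of_ne hk]
      refine ⟨h3, ?_⟩
      rw [hRo _ (by rintro h5; rw [h5] at h4; omega), h4]
  · intro k h1 h2
    by_cases hk : k = c
    · subst hk
      simp only [Function.update_self]
      refine ⟨hxn, hyn, hF.imp_right ?_⟩
      rintro ⟨hxv, hyv, ⟨hx, hx0⟩, hy, hy0⟩
      rw [hRo x hxv, hRo y hyv]
      -- The entries just inserted make `x` and `y` adjacent while both remain; `Recorded` survives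
      -- later steps, so the attached pair is still a recorded pair at the end.
      refine ⟨by omega, by omega, Or.inr (Or.inl ?_)⟩
      rw [hRo x hxv, hRo y hyv]
      exact ⟨hx0, hy0, (hL x y hxv).2 (by simp), (hL y x hyv).2 (by simp)⟩
    · obtain ⟨h3, h4, h5⟩ := h.attach k (by omega) h2
      have hlt : ∀ u, R u < k → Function.update R v c u < k := fun u hu => by
        by_cases huv : u = v
        · rw [huv, hRv]
          omega
        · rwa [hRo u huv]
      rw [Function.update_of_ne hk, Function.update_of_ne hk, Function.update_of_ne hk]
      refine ⟨h3, h4, h5.imp_right fun ⟨h6, h7, h8⟩ => ⟨hlt _ h6, hlt _ h7, ?_⟩⟩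
      by_cases hne : A k = B k
      · exact Or.inl hne
      · exact Or.inr (hrec _ _ hne (h8.resolve_left hne))

/-- Only the neighbours of the eliminated vertex can become low. -/
theorem low_of_step (h : Elimination n E R X A B c L) {v x y : ℕ} (hv : v < n) (hR : R v = 0)
    (hcomp : ∀ w ∈ L v, R w = 0 → w ≠ v → w = x ∨ w = y)
    (hL : ∀ u w, u ≠ v → (w ∈ L' u ↔ w ∈ L u ∨ (u = x ∧ w = y) ∨ (u = y ∧ w = x)))
    {u : ℕ} (hu : Function.update R v c u = 0) (hux : u ≠ x) (huy : u ≠ y)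
    (hlow : Low (Function.update R v c) L' u) : u ≠ v ∧ R u = 0 ∧ Low R L u := by
  have huv : u ≠ v := by
    rintro rfl
    have := h.pos hv hR
    simp at hu
    omega
  rw [Function.update_of_ne huv] at hu
  refine ⟨huv, hu, ?_⟩
  obtain ⟨x', y', hxy⟩ := hlow
  refine ⟨x', y', fun w hw hw0 hwu => ?_⟩
  -- If `v` itself was a neighbour of `u`, symmetry puts `u` among the neighbours of `v`, that is,
  -- `u` is `x` or `y`.
  by_cases hwv : w = v
  · subst hwv
    have := hcomp u (h.symm u w hu hw0 hw) hu hwu.symm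
    tauto
  · exact hxy w ((hL u w huv).2 (Or.inl hw)) (by rwa [Function.update_of_ne hwv]) hwu

/-- As long as there are vertices left, one of them has at most two neighbours. -/
theorem exists_low (h : Elimination n E R X A B c L) (hc : 0 < c) :
    ∃ v < n, R v = 0 ∧ Low R L v := by
  have hne : ((Finset.range n).filter fun u => R u = 0).Nonempty := by
    rw [← Finset.card_pos, h.card]
    exact hc
  obtain ⟨v, hv, x, y, hxy⟩ := h.width.exists_low _ hne fun u w ⟨h1, h2, h3, h4⟩ => by
    refine ⟨h1, ?_, ?_⟩
    · simpa [h2] using h.mem_lt w u (h.symm u w h2 h3 h4)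
    · simpa [h3] using h.mem_lt u w h4
  simp only [Finset.mem_filter, Finset.mem_range] at hv
  exact ⟨v, hv.1, hv.2, x, y, fun w h1 h2 h3 => hxy w ⟨h3.symm, hv.2, h2, h1⟩⟩

end Elimination

theorem not_low_of_three {R : ℕ → ℕ} {L : ℕ → List ℕ} {v a b c : ℕ} (hab : a ≠ b) (hac : a ≠ c)
    (hbc : b ≠ c) (h : ∀ w, w = a ∨ w = b ∨ w = c → w ∈ L v ∧ R w = 0 ∧ w ≠ v) :
    ¬ Low R L v := by
  rintro ⟨x, y, hxy⟩
  have key : ∀ w, w = a ∨ w = b ∨ w = c → w = x ∨ w = y := fun w hw =>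
    hxy w (h w hw).1 (h w hw).2.1 (h w hw).2.2
  have h1 := key a (by simp)
  have h2 := key b (by simp)
  have h3 := key c (by simp)
  omega

/-! ### The main loop of the elimination -/

namespace RAM.Program

/-- The total length of the lists. -/
def totalLength (n : ℕ) (L : ℕ → List ℕ) : ℕ := ∑ v ∈ Finset.range n, (L v).length

theorem totalLength_update {n v : ℕ} (hv : v < n) (L : ℕ → List ℕ) (l : List ℕ) :
    totalLength n (Function.update L v l) + (L v).length = totalLength n L + l.length := by
  have hmem : v ∈ Finset.range n := Finset.mem_range.2 hv
  unfold totalLength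
  rw [← Finset.add_sum_erase _ _ hmem, ← Finset.add_sum_erase _ _ hmem, Function.update_self]
  have : ∑ u ∈ (Finset.range n).erase v, (Function.update L v l u).length =
      ∑ u ∈ (Finset.range n).erase v, (L u).length :=
    Finset.sum_congr rfl fun u hu => by
      rw [Function.update_of_ne (Finset.ne_of_mem_erase hu)]
  omega

theorem length_le_totalLength {n v : ℕ} (hv : v < n) (L : ℕ → List ℕ) :
    (L v).length ≤ totalLength n L :=
  Finset.single_le_sum (f := fun v => (L v).length) (fun _ _ => Nat.zero_le _)
    (Finset.mem_range.2 hv)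

/-- Eliminate the vertex in register `8` with neighbours in the registers `9` and `10`. -/
def eliminate : Program :=
  block [store 8 8 7, store 9 7 8, store 10 7 9, store 11 7 10, store 4 8 3, minus 7 7 2,
    push 9 10, push 10 9, store 7 5 9, plus 5 5 2, store 7 5 10, plus 5 5 2]

/-- Eliminate the vertex in register `8` if it has at most two neighbours. -/
def examine : Program :=
  block [move 9 8, move 10 8, move 14 3, load 11 4 8, scan, branch (.ne 14 3) nop eliminate]

/-- Examine the vertices in the queue until it is empty. -/
def reduce : Program :=
  loop (.lt 6 5) (block [load 8 7 6, plus 6 6 2, load 13 8 8, branch (.ne 13 3) nop examine])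

/-- The invariant of the main loop; the vertices with property `ex` need not be in the queue. -/
structure Invariant (n D : ℕ) (E : ℕ → ℕ → Prop) (ex : ℕ → Prop) (L : ℕ → List ℕ)
    (s : State) : Prop where
  size : s.reg 0 = n
  one : s.reg 2 = 1
  zero : s.reg 3 = 0
  heap : Heap s L
  elimination : Elimination n E (s.arr 8) (s.arr 9) (s.arr 10) (s.arr 11) (s.reg 7) L
  queue : ∀ u < n, ¬ ex u → s.arr 8 u = 0 → Low (s.arr 8) L u →
    ∃ i, s.reg 6 ≤ i ∧ i < s.reg 5 ∧ s.arr 7 i = u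
  queue_lt : ∀ i < s.reg 5, s.arr 7 i < n
  front_le : s.reg 6 ≤ s.reg 5
  back_le : s.reg 5 + 2 * s.reg 7 ≤ 3 * n
  free_le : s.reg 4 ≤ D + 3 * s.reg 6

/-- The time needed for the rest of the elimination. -/
def potential (n : ℕ) (L : ℕ → List ℕ) (s : State) : ℕ :=
  300 * (s.reg 5 - s.reg 6) + 700 * s.reg 7 + 40 * totalLength n L + 2

variable {n D W k : ℕ} {E : ℕ → ℕ → Prop} {L : ℕ → List ℕ} {s : State}

/-- An elimination removes one vertex (`-700`) and adds two queue entries (`+600`) and two list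
cells (`+80`), so the potential drops by `20` besides the `40` for each cell of the discarded list
of `v`, which pays for its scan. Since each elimination enqueues two vertices, the queue never
exceeds `3 * n` entries; each dequeued vertex allocates at most three cells. This gives the word
bound. -/
theorem runs_eliminate (h : Invariant n D E (fun u => u = s.reg 8) L s) (hv : s.reg 8 < n)
    (hR : s.arr 8 (s.reg 8) = 0)
    (hF : Found (s.arr 8) (L (s.reg 8)) (s.reg 8) (s.reg 9) (s.reg 10))
    (hC : ∀ w ∈ L (s.reg 8), s.arr 8 w = 0 → w ≠ s.reg 8 → w = s.reg 9 ∨ w = s.reg 10)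
    (hfree : s.reg 4 + 3 ≤ D + 3 * s.reg 6) (hW : D + 9 * n + 9 ≤ W)
    (hk : potential n L s + 60 ≤ k + 40 * (L (s.reg 8)).length) (hk' : 60 ≤ k) :
    Runs W eliminate s k fun k' s' => ∃ L', Invariant n D E (fun _ => False) L' s' ∧
      potential n L' s' + 2 ≤ k' := by
  have h2 := h.one
  have hfr := h.front_le
  have hbk := h.back_le
  have hpos := h.elimination.pos hv hR
  apply runs_store (by omega)
  apply runs_store (by omega)
  apply runs_store (by omega)
  apply runs_store (by omega)
  apply runs_store (by omega)
  apply runs_minus (by omega)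
  simp only [State.reg_setArr]
  obtain ⟨v, hv'⟩ : ∃ v, v = s.reg 8 := ⟨_, rfl⟩
  obtain ⟨x, hx⟩ : ∃ x, x = s.reg 9 := ⟨_, rfl⟩
  obtain ⟨y, hy⟩ : ∃ y, y = s.reg 10 := ⟨_, rfl⟩
  obtain ⟨c, hc⟩ : ∃ c, c = s.reg 7 := ⟨_, rfl⟩
  rw [← hv'] at hv hR
  simp only [← hv', ← hx, ← hy] at hF hC
  have hxn : x < n := by
    rcases hF with hF | hF
    · rw [hF.1]
      exact hv
    · exact h.elimination.mem_lt v x hF.2.2.1.1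
  have hyn : y < n := by
    rcases hF with hF | hF
    · rw [hF.2]
      exact hv
    · exact h.elimination.mem_lt v y hF.2.2.2.1
  rw [← hv', ← hx, ← hy, ← hc, h.zero, h2]
  obtain ⟨s₁, hs₁⟩ : ∃ s₁ : State, s₁ = (((((s.setArr 8 v c).setArr 9 c v).setArr 10 c x).setArr
    11 c y).setArr 4 v 0).setReg 7 (c - 1) := ⟨_, rfl⟩
  rw [← hs₁]
  have hr₁ : ∀ z, z ≠ 7 → s₁.reg z = s.reg z := fun z hz => by simp [hs₁, hz]
  have h7₁ : s₁.reg 7 = c - 1 := by simp [hs₁]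
  have hheap₁ : Heap s₁ (Function.update L v []) :=
    h.heap.set_head (c := 0) (l := []) rfl (by simp [hs₁]) (by simp [hs₁]) (by simp [hs₁])
      (by simp [hs₁])
  refine runs_cons (runs_push (by omega) hheap₁ (by rw [hr₁ 2 (by omega), h2])
    (by rw [hr₁ 4 (by omega)]; omega) (by omega) fun s₂ P₂ => ?_)
  refine runs_cons (runs_push (by omega) P₂.heap
    (by rw [P₂.reg 2 (by omega) (by omega), hr₁ 2 (by omega), h2])
    (by rw [P₂.free, hr₁ 4 (by omega)]; omega) (by omega) fun s₃ P₃ => ?_)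
  have hheap := P₃.heap
  have hr₃ : ∀ z, z ≠ 4 → z ≠ 7 → z ≠ 13 → s₃.reg z = s.reg z := fun z z4 z7 z13 => by
    rw [P₃.reg z z4 z13, P₂.reg z z4 z13, hr₁ z z7]
  have h4₃ : s₃.reg 4 = s.reg 4 + 2 := by rw [P₃.free, P₂.free, hr₁ 4 (by omega)]
  have h7₃ : s₃.reg 7 = c - 1 := by
    rw [P₃.reg 7 (by omega) (by omega), P₂.reg 7 (by omega) (by omega), h7₁]
  have ha₃ : ∀ A, A ≠ 4 → A ≠ 5 → A ≠ 6 → s₃.arr A = s₁.arr A := fun A a4 a5 a6 => by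
    rw [P₃.arr A a4 a5 a6, P₂.arr A a4 a5 a6]
  rw [P₂.reg 9 (by omega) (by omega), P₂.reg 10 (by omega) (by omega), hr₁ 9 (by omega),
    hr₁ 10 (by omega), ← hx, ← hy] at hheap
  obtain ⟨L', hL'⟩ : ∃ L', L' = Function.update (Function.update (Function.update L v []) x
    (y :: Function.update L v [] x)) y
      (x :: Function.update (Function.update L v []) x (y :: Function.update L v [] x) y) :=
    ⟨_, rfl⟩
  rw [← hL'] at hheap
  have hlen : totalLength n L' + (L v).length = totalLength n L + 2 := by
    have e1 := totalLength_update hv L []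
    have e2 := totalLength_update hxn (Function.update L v []) (y :: Function.update L v [] x)
    have e3 := totalLength_update hyn (Function.update (Function.update L v []) x
      (y :: Function.update L v [] x))
      (x :: Function.update (Function.update L v []) x (y :: Function.update L v [] x) y)
    rw [← hL'] at e3
    simp only [List.length_cons, List.length_nil] at e1 e2 e3
    omega
  -- This form is insensitive to coincidences: `x = y` is a single neighbour, and `x = y = v` is no
  -- neighbour, where the eliminated `v` lists and enqueues itself harmlessly.
  have hmem : ∀ u w, w ∈ L' u ↔ (u ≠ v ∧ w ∈ L u) ∨ (u = x ∧ w = y) ∨ (u = y ∧ w = x) := by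
    intro u w
    have m1 : ∀ u, w ∈ Function.update L v [] u ↔ u ≠ v ∧ w ∈ L u := fun u => by
      by_cases hu : u = v <;> simp [hu]
    have m2 : ∀ u, w ∈ Function.update (Function.update L v []) x
        (y :: Function.update L v [] x) u ↔ (u ≠ v ∧ w ∈ L u) ∨ (u = x ∧ w = y) := fun u => by
      by_cases hu : u = x
      · subst hu
        rw [Function.update_self, List.mem_cons, m1]
        tauto
      · rw [Function.update_of_ne hu, m1]
        tauto
    rw [hL']
    by_cases hu : u = y
    · subst hu
      rw [Function.update_self, List.mem_cons, m2]
      tauto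
    · rw [Function.update_of_ne hu, m2]
      tauto
  have hL1 : ∀ u w, u ≠ v → (w ∈ L' u ↔ w ∈ L u ∨ (u = x ∧ w = y) ∨ (u = y ∧ w = x)) := by
    intro u w hu
    rw [hmem]
    tauto
  have hL2 : ∀ w ∈ L' v, w = x ∨ w = y := by
    intro w hw
    rw [hmem] at hw
    tauto
  have hstep := h.elimination.step hv hR hF hC hL1 hL2
  have hlow := fun u => h.elimination.low_of_step hv hR hC hL1 (u := u)
  rw [← hc] at hstep hlow
  apply runs_store (by omega)
  apply runs_plus (by omega)
  · simp only [State.reg_setArr]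
    rw [hr₃ 5 (by omega) (by omega) (by omega), hr₃ 2 (by omega) (by omega) (by omega)]
    omega
  apply runs_store (by omega)
  apply runs_plus (by omega)
  · simp
    rw [hr₃ 5 (by omega) (by omega) (by omega), hr₃ 2 (by omega) (by omega) (by omega)]
    omega
  apply runs_nil (by omega)
  simp only [State.reg_setReg, State.reg_setArr, Nat.reduceEqDiff, if_true,
    if_false]
  rw [hr₃ 5 (by omega) (by omega) (by omega), hr₃ 2 (by omega) (by omega) (by omega),
    hr₃ 9 (by omega) (by omega) (by omega), hr₃ 10 (by omega) (by omega) (by omega), h2, ← hx, ← hy]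
  obtain ⟨s₄, hs₄⟩ : ∃ s₄ : State, s₄ = (((s₃.setArr 7 (s.reg 5) x).setReg 5 (s.reg 5 + 1)).setArr
    7 (s.reg 5 + 1) y).setReg 5 (s.reg 5 + 1 + 1) := ⟨_, rfl⟩
  rw [← hs₄]
  have hr : ∀ z, z ≠ 5 → s₄.reg z = s₃.reg z := fun z hz => by simp [hs₄, hz]
  have h5 : s₄.reg 5 = s.reg 5 + 2 := by simp [hs₄]
  have h6 : s₄.reg 6 = s.reg 6 := by
    rw [hr 6 (by omega), hr₃ 6 (by omega) (by omega) (by omega)]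
  have h7 : s₄.reg 7 = c - 1 := by rw [hr 7 (by omega), h7₃]
  have ha : ∀ A, A ≠ 7 → s₄.arr A = s₃.arr A := fun A hA => by simp [hs₄, hA]
  have ha7 : s₄.arr 7 = Function.update (Function.update (s.arr 7) (s.reg 5) x)
      (s.reg 5 + 1) y := by
    simp [hs₄, ha₃, hs₁]
  have ha8 : s₄.arr 8 = Function.update (s.arr 8) v c := by
    rw [ha 8 (by omega), ha₃ 8 (by omega) (by omega) (by omega)]
    simp [hs₁]
  have ha9 : s₄.arr 9 = Function.update (s.arr 9) c v := by
    rw [ha 9 (by omega), ha₃ 9 (by omega) (by omega) (by omega)]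
    simp [hs₁]
  have ha10 : s₄.arr 10 = Function.update (s.arr 10) c x := by
    rw [ha 10 (by omega), ha₃ 10 (by omega) (by omega) (by omega)]
    simp [hs₁]
  have ha11 : s₄.arr 11 = Function.update (s.arr 11) c y := by
    rw [ha 11 (by omega), ha₃ 11 (by omega) (by omega) (by omega)]
    simp [hs₁]
  refine ⟨L', ⟨?_, ?_, ?_, ?_, ?_, ?_, ?_, ?_, ?_, ?_⟩, ?_⟩
  · rw [hr 0 (by omega), hr₃ 0 (by omega) (by omega) (by omega), h.size]
  · rw [hr 2 (by omega), hr₃ 2 (by omega) (by omega) (by omega), h.one]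
  · rw [hr 3 (by omega), hr₃ 3 (by omega) (by omega) (by omega), h.zero]
  · exact hheap.congr (hr 4 (by omega)) (ha 4 (by omega)) (ha 5 (by omega)) (ha 6 (by omega))
  · rw [ha8, ha9, ha10, ha11, h7]
    exact hstep
  · intro u hu _ hu0 hul
    rw [ha8] at hu0 hul
    rw [h5, h6, ha7]
    by_cases huy : u = y
    · exact ⟨s.reg 5 + 1, by omega, by omega, by simp [huy]⟩
    by_cases hux : u = x
    · refine ⟨s.reg 5, by omega, by omega, ?_⟩
      rw [Function.update_of_ne (by omega), Function.update_self, hux]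
    -- Any low vertex other than `x` and `y` was low before, hence already queued, and the two new
    -- entries go behind the old ones.
    obtain ⟨huv, hu0', hul'⟩ := hlow u hu0 hux huy hul
    obtain ⟨i, hi1, hi2, hi3⟩ := h.queue u hu (by rwa [← hv']) hu0' hul'
    refine ⟨i, hi1, by omega, ?_⟩
    rwa [Function.update_of_ne (by omega), Function.update_of_ne (by omega)]
  · intro i hi
    rw [h5] at hi
    rw [ha7, Function.update_apply, Function.update_apply]
    split_ifs with hi1 hi2
    exacts [hyn, hxn, h.queue_lt i (by omega)]
  · omega
  · omega
  · rw [hr 4 (by omega), h4₃, h6]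
    omega
  · simp only [potential] at hk ⊢
    rw [h5, h6, h7]
    rw [← hv'] at hk
    omega

theorem Invariant.congr {ex : ℕ → Prop} {s' : State} (h : Invariant n D E ex L s)
    (hr : ∀ x, x < 8 → s'.reg x = s.reg x) (ha : s'.arr = s.arr) : Invariant n D E ex L s' := by
  refine ⟨?_, ?_, ?_, ?_, ?_, ?_, ?_, ?_, ?_, ?_⟩
  · rw [hr 0 (by omega), h.size]
  · rw [hr 2 (by omega), h.one]
  · rw [hr 3 (by omega), h.zero]
  · exact h.heap.congr (hr 4 (by omega)) (by rw [ha]) (by rw [ha]) (by rw [ha])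
  · rw [ha, hr 7 (by omega)]
    exact h.elimination
  · rw [ha, hr 5 (by omega), hr 6 (by omega)]
    exact h.queue
  · rw [ha, hr 5 (by omega)]
    exact h.queue_lt
  · rw [hr 5 (by omega), hr 6 (by omega)]
    exact h.front_le
  · rw [hr 5 (by omega), hr 7 (by omega)]
    exact h.back_le
  · rw [hr 4 (by omega), hr 6 (by omega)]
    exact h.free_le

/-- The vertex in register `8` has left the queue. Either it is eliminated, or the scan has found
three neighbours and it is not low, so that it need not be queued. The extra `280` comes from the
`300` released by dequeuing. -/
theorem runs_examine (h : Invariant n D E (fun u => u = s.reg 8) L s) (hv : s.reg 8 < n)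
    (hR : s.arr 8 (s.reg 8) = 0)
    (hfree : s.reg 4 + 3 ≤ D + 3 * s.reg 6) (hW : D + 9 * n + 9 ≤ W)
    (hk : potential n L s + 280 ≤ k) :
    Runs W examine s k fun k' s' => ∃ L', Invariant n D E (fun _ => False) L' s' ∧
      potential n L' s' + 1 ≤ k' := by
  have hfr := h.front_le
  have hbk := h.back_le
  apply runs_move (by omega)
  apply runs_move (by omega)
  apply runs_move (by omega)
  apply runs_load (by omega)
  simp only [State.reg_setReg, State.arr_setReg, Nat.reduceEqDiff, if_false, h.zero]
  obtain ⟨s₁, hs₁⟩ : ∃ s₁ : State, s₁ = (((s.setReg 9 (s.reg 8)).setReg 10 (s.reg 8)).setReg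
    14 0).setReg 11 (s.arr 4 (s.reg 8)) := ⟨_, rfl⟩
  rw [← hs₁]
  have ha : s₁.arr = s.arr := by simp [hs₁]
  have hr : ∀ x, x < 9 → s₁.reg x = s.reg x := fun x hx => by
    simp [hs₁, show x ≠ 9 by omega, show x ≠ 10 by omega, show x ≠ 11 by omega,
      show x ≠ 14 by omega]
  have r8 := hr 8 (by omega)
  have r9 : s₁.reg 9 = s.reg 8 := by simp [hs₁]
  have r10 : s₁.reg 10 = s.reg 8 := by simp [hs₁]
  have r11 : s₁.reg 11 = s.arr 4 (s.reg 8) := by simp [hs₁]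
  have r14 : s₁.reg 14 = 0 := by simp [hs₁]
  have h₁ : Invariant n D E (fun u => u = s.reg 8) L s₁ :=
    h.congr (fun x hx => hr x (by omega)) ha
  have hlen := length_le_totalLength hv L
  have hpot : potential n L s = 300 * (s.reg 5 - s.reg 6) + 700 * s.reg 7 +
    40 * totalLength n L + 2 := rfl
  refine runs_cons ((runs_scan (L (s.reg 8)) h₁.heap h₁.one h₁.zero r14
    (by rw [hr 4 (by omega)]; omega) (by rw [ha, r11, hr 4 (by omega)]; exact h.heap.cells _)
    (fun w hw => by rwa [r8]) (Or.inl ⟨by rw [r9, r8], by rw [r10, r8]⟩)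
    (fun w hw _ _ => Or.inl (by rwa [r8] at hw)) (by omega)).mono fun k₂ s₂ _ P => ?_)
  have p8 : s₂.reg 8 = s.reg 8 := (P.reg 8 (by omega) (by omega)).trans r8
  have pr : ∀ x, x < 9 → x ≠ 4 → s₂.reg x = s.reg x := fun x hx hx4 =>
    (P.reg x hx4 (by omega)).trans (hr x hx)
  have pa : ∀ A, A ≠ 4 → A ≠ 5 → A ≠ 6 → s₂.arr A = s.arr A := fun A a4 a5 a6 => by
    rw [P.arr A a4 a5 a6, ha]
  have p3 : s₂.reg 3 = 0 := (pr 3 (by omega) (by omega)).trans h.zero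
  -- A scan touches only the heap and scratch registers; what is left to prove concerns the lists
  -- and the queue.
  have pinv : ∀ (ex : ℕ → Prop) (L' : ℕ → List ℕ), Heap s₂ L' →
      Elimination n E (s.arr 8) (s.arr 9) (s.arr 10) (s.arr 11) (s.reg 7) L' →
      (∀ u < n, ¬ ex u → s.arr 8 u = 0 → Low (s.arr 8) L' u → u ≠ s.reg 8 ∧ Low (s.arr 8) L u) →
      s₂.reg 4 ≤ s.reg 4 + 3 → Invariant n D E ex L' s₂ := by
    intro ex L' hh he hq h4
    refine ⟨?_, ?_, p3, hh, ?_, ?_, ?_, ?_, ?_, ?_⟩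
    · rw [pr 0 (by omega) (by omega), h.size]
    · rw [pr 2 (by omega) (by omega), h.one]
    · rw [pa 8 (by omega) (by omega) (by omega), pa 9 (by omega) (by omega) (by omega),
        pa 10 (by omega) (by omega) (by omega), pa 11 (by omega) (by omega) (by omega),
        pr 7 (by omega) (by omega)]
      exact he
    · rw [pa 8 (by omega) (by omega) (by omega), pa 7 (by omega) (by omega) (by omega),
        pr 5 (by omega) (by omega), pr 6 (by omega) (by omega)]
      intro u hu hex hu0 hul
      obtain ⟨h1, h2⟩ := hq u hu hex hu0 hul
      exact h.queue u hu h1 hu0 h2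
    · rw [pa 7 (by omega) (by omega) (by omega), pr 5 (by omega) (by omega)]
      exact h.queue_lt
    · rw [pr 5 (by omega) (by omega), pr 6 (by omega) (by omega)]
      exact hfr
    · rw [pr 5 (by omega) (by omega), pr 7 (by omega) (by omega)]
      exact hbk
    · rw [pr 6 (by omega) (by omega)]
      omega
  have ppot : ∀ L', potential n L' s₂ = 300 * (s.reg 5 - s.reg 6) + 700 * s.reg 7 +
      40 * totalLength n L' + 2 := fun L' => by
    rw [potential, pr 5 (by omega) (by omega), pr 6 (by omega) (by omega),
      pr 7 (by omega) (by omega)]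
  refine runs_cons ?_
  rcases P.result with ⟨hl, hb⟩ | ⟨l', hl, hb⟩
  · refine runs_branch (by omega) (fun hcon => ?_) fun _ => ?_
    · exact absurd hl.flag (by simpa [Test.Holds, p3] using hcon)
    have hinv : Invariant n D E (fun u => u = s₂.reg 8) L s₂ :=
      pinv _ L hl.heap h.elimination (fun u _ hu _ hul => ⟨by rwa [p8] at hu, hul⟩) (by
        rw [hl.free, hr 4 (by omega)]
        omega)
    have hfound := hl.found
    have hcomp := hl.complete
    rw [ha, r8] at hfound hcomp
    refine (runs_eliminate (k := k₂ - 1) hinv (by rwa [p8]) ?_ ?_ ?_ ?_ hW ?_ ?_).mono ?_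
    · rwa [pa 8 (by omega) (by omega) (by omega), p8]
    · rwa [pa 8 (by omega) (by omega) (by omega), p8]
    · rwa [pa 8 (by omega) (by omega) (by omega), p8]
    · rw [hl.free, hr 4 (by omega), pr 6 (by omega) (by omega)]
      exact hfree
    · rw [ppot, p8]
      omega
    · omega
    · rintro k' s' _ ⟨L', h1, h2⟩
      exact runs_nil (by omega) ⟨L', h1, by omega⟩
  · refine runs_branch (by omega) (fun _ => ?_) fun hcon => ?_
    swap
    · exact absurd hl.flag (by simpa [Test.Holds, p3] using hcon)
    have hlen' := totalLength_update hv L l'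
    have hheap := hl.heap
    have hsub := hl.subset
    have hcomp := hl.complete
    have hthree := hl.three
    simp only [ha, r8] at hheap hsub hcomp hthree
    refine runs_nop (by omega) (runs_nil (by omega) ⟨Function.update L (s.reg 8) l', ?_, ?_⟩)
    · refine pinv _ _ hheap (h.elimination.shorten hR hsub hcomp) ?_ ?_
      · intro u _ _ _ hul
        by_cases hu : u = s.reg 8
        · exfalso
          obtain ⟨a, b, c, hab, hac, hbc, hw⟩ := hthree
          refine not_low_of_three hab hac hbc (fun w hw' => ?_) hul
          obtain ⟨w1, w2, w3⟩ := hw w hw'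
          rw [hu, Function.update_self]
          exact ⟨hcomp w w1 w2 w3, w2, w3⟩
        · refine ⟨hu, ?_⟩
          rwa [Low, Function.update_of_ne hu] at hul
      · rw [hl.free, hr 4 (by omega)]
    · rw [ppot]
      omega

/-- The potential is the credit carried by the loop invariant; it drops by `300` at each dequeuing,
before the examination is paid. -/
theorem runs_reduce (h : Invariant n D E (fun _ => False) L s) (hW : D + 9 * n + 9 ≤ W)
    (hk : potential n L s ≤ k) :
    Runs W reduce s k fun _ s' => s'.reg 0 = n ∧ s'.reg 2 = 1 ∧ s'.reg 3 = 0 ∧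
      ∃ L', Elimination n E (s'.arr 8) (s'.arr 9) (s'.arr 10) (s'.arr 11) 0 L' := by
  refine (runs_loop (fun k s => ∃ L, Invariant n D E (fun _ => False) L s ∧ potential n L s ≤ k)
    (fun k s ⟨L, _, h2⟩ => ?_) (fun k s ⟨L, h, hk⟩ hlt => ?_) ⟨L, h, hk⟩).mono
      fun k' s' _ ⟨⟨L', h', _⟩, hb⟩ => ?_
  · rw [potential] at h2
    omega
  · simp only [Test.Holds] at hlt
    have hbk := h.back_le
    have hpot : potential n L s = 300 * (s.reg 5 - s.reg 6) + 700 * s.reg 7 +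
      40 * totalLength n L + 2 := rfl
    apply runs_load (by omega)
    apply runs_plus (by omega)
    · simp [h.one]
      omega
    apply runs_load (by omega)
    apply runs_cons
    simp only [State.reg_setReg, State.arr_setReg, Nat.reduceEqDiff, if_true, if_false, h.one]
    obtain ⟨v, hv⟩ : ∃ v, v = s.arr 7 (s.reg 6) := ⟨_, rfl⟩
    rw [← hv]
    have hvn : v < n := hv ▸ h.queue_lt _ hlt
    obtain ⟨s₁, hs₁⟩ : ∃ s₁ : State, s₁ = ((s.setReg 8 v).setReg 6 (s.reg 6 + 1)).setReg 13
      (s.arr 8 v) := ⟨_, rfl⟩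
    rw [← hs₁]
    have ha : s₁.arr = s.arr := by simp [hs₁]
    have hr : ∀ x, x < 8 → x ≠ 6 → s₁.reg x = s.reg x := fun x hx hx6 => by
      simp [hs₁, hx6, show x ≠ 8 by omega, show x ≠ 13 by omega]
    have r6 : s₁.reg 6 = s.reg 6 + 1 := by simp [hs₁]
    have r8 : s₁.reg 8 = v := by simp [hs₁]
    have r13 : s₁.reg 13 = s.arr 8 v := by simp [hs₁]
    have hinv : ∀ ex : ℕ → Prop, (∀ u, ¬ ex u → s.arr 8 u = 0 → u ≠ v) →
        Invariant n D E ex L s₁ := by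
      intro ex hex
      refine ⟨?_, ?_, ?_, ?_, ?_, ?_, ?_, ?_, ?_, ?_⟩
      · rw [hr 0 (by omega) (by omega), h.size]
      · rw [hr 2 (by omega) (by omega), h.one]
      · rw [hr 3 (by omega) (by omega), h.zero]
      · exact h.heap.congr (hr 4 (by omega) (by omega)) (by rw [ha]) (by rw [ha]) (by rw [ha])
      · rw [ha, hr 7 (by omega) (by omega)]
        exact h.elimination
      · rw [ha, hr 5 (by omega) (by omega), r6]
        intro u hu hu' hu0 hul
        obtain ⟨i, h1, h2, h3⟩ := h.queue u hu (by simp) hu0 hul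
        refine ⟨i, ?_, h2, h3⟩
        -- Only the front entry leaves the queue, and it holds `v`.
        rcases h1.lt_or_eq with h4 | h4
        · omega
        · refine absurd ?_ (hex u hu' hu0)
          rw [← h3, ← h4, hv]
      · rw [ha, hr 5 (by omega) (by omega)]
        exact h.queue_lt
      · rw [r6, hr 5 (by omega) (by omega)]
        omega
      · rw [hr 5 (by omega) (by omega), hr 7 (by omega) (by omega)]
        exact h.back_le
      · have := h.free_le
        rw [hr 4 (by omega) (by omega), r6]
        omega
    have hpot₁ : potential n L s₁ + 300 = potential n L s := by
      rw [potential, potential, r6, hr 5 (by omega) (by omega), hr 7 (by omega) (by omega)]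
      omega
    refine runs_branch (by omega) (fun hb => ?_) fun hb => ?_
    · have hne : s.arr 8 v ≠ 0 := by
        simpa [Test.Holds, r13, hr 3 (by omega) (by omega), h.zero] using hb
      refine runs_nop (by omega) (runs_nil (by omega) ⟨L, hinv _ ?_, by omega⟩)
      rintro u - hu0 rfl
      exact hne hu0
    · have h0 : s.arr 8 v = 0 := by
        simpa [Test.Holds, r13, hr 3 (by omega) (by omega), h.zero] using hb
      refine (runs_examine (k := k - 1 - 1 - 1 - 1 - 1) (hinv _ ?_) (by rwa [r8]) ?_ ?_ hW
        (by omega)).mono ?_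
      · intro u hu _ huv
        exact hu (huv.trans r8.symm)
      · rwa [ha, r8]
      · have := h.free_le
        rw [hr 4 (by omega) (by omega), r6]
        omega
      · rintro k' s' _ ⟨L', h1, h2⟩
        exact runs_nil (by omega) ⟨L', h1, by omega⟩
  · have hle := h'.front_le
    simp only [Test.Holds, not_lt] at hb
    refine ⟨h'.size, h'.one, h'.zero, L', ?_⟩
    -- The queue is empty, so no low vertex remains; but a nonempty remainder always has one. Hence
    -- everything is eliminated.
    rcases Nat.eq_zero_or_pos (s'.reg 7) with h0 | h0
    · rw [← h0]
      exact h'.elimination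
    · obtain ⟨v, hv, hv0, hvl⟩ := h'.elimination.exists_low h0
      obtain ⟨i, h1, h2, -⟩ := h'.queue v hv (by simp) hv0 hvl
      omega

end RAM.Program

/-! ### Building the adjacency lists -/

namespace RAM.Program

/-- Fill the queue with all vertices. -/
def fillQueue : Program := loop (.lt 15 0) (block [store 7 15 15, plus 15 15 2])

/-- Enter all edges into the adjacency lists. -/
def readEdges : Program :=
  loop (.lt 16 1) (block [load 8 0 16, load 12 1 16, push 8 12, push 12 8, plus 16 16 2])

/-- Set up the data structures for the elimination. -/
def build : Program :=
  block [const 2 1, const 4 1, fillQueue, readEdges, move 5 0, move 7 0]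

variable {n m W k r : ℕ} {s : State}

/-- Here and below, `r` is credit reserved for the programs that follow. -/
theorem runs_fillQueue (h0 : s.reg 0 = n) (h2 : s.reg 2 = 1) (h15 : s.reg 15 = 0)
    (hW : n ≤ W) (hk : 4 * n + 1 + r ≤ k) :
    Runs W fillQueue s k fun k' s' => r ≤ k' ∧ (∀ x, x ≠ 15 → s'.reg x = s.reg x) ∧
      (∀ A, A ≠ 7 → s'.arr A = s.arr A) ∧ ∀ i < n, s'.arr 7 i = i := by
  refine (runs_loop (fun k s' => (∀ x, x ≠ 15 → s'.reg x = s.reg x) ∧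
      (∀ A, A ≠ 7 → s'.arr A = s.arr A) ∧ (∀ i < s'.reg 15, s'.arr 7 i = i) ∧ s'.reg 15 ≤ n ∧
      4 * (n - s'.reg 15) + 1 + r ≤ k) (fun k s' ⟨_, _, _, _, h⟩ => by omega) ?_
      ⟨fun _ _ => rfl, fun _ _ => rfl, by simp [h15], by omega, by rw [h15]; omega⟩).mono ?_
  · rintro k s' ⟨hr, ha, hq, hn, hk⟩ hlt
    simp only [Test.Holds, hr 0 (by omega), h0] at hlt
    have r2 : s'.reg 2 = 1 := (hr 2 (by omega)).trans h2
    apply runs_store (by omega)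
    apply runs_plus (by omega) (by simp [r2]; omega)
    refine runs_nil (by omega) ⟨?_, ?_, ?_, ?_, ?_⟩
    · intro x hx
      simp [hx, hr x hx]
    · intro A hA
      simp [hA, ha A hA]
    · intro i hi
      simp only [State.reg_setReg, State.reg_setArr, State.arr_setReg, State.arr_setArr, if_true,
        r2] at hi ⊢
      by_cases h : i = s'.reg 15
      · rw [h, Function.update_self]
      · rw [Function.update_of_ne h, hq i (by omega)]
    · simp [r2]
      omega
    · simp [r2]
      omega
  · rintro k' s' - ⟨⟨hr, ha, hq, hn, hk⟩, hb⟩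
    simp only [Test.Holds, hr 0 (by omega), h0, not_lt] at hb
    exact ⟨by omega, hr, ha, fun i hi => hq i (by omega)⟩

/-- The lists contain exactly the pairs `a j, b j` with `j < i`. -/
def ListsPairs (a b : ℕ → ℕ) (i : ℕ) (L : ℕ → List ℕ) : Prop :=
  ∀ u w, w ∈ L u ↔ ∃ j < i, (u = a j ∧ w = b j) ∨ (u = b j ∧ w = a j)

theorem ListsPairs.succ {a b : ℕ → ℕ} {i : ℕ} {L : ℕ → List ℕ} (h : ListsPairs a b i L) :
    ListsPairs a b (i + 1) (Function.update (Function.update L (a i) (b i :: L (a i))) (b i)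
      (a i :: Function.update L (a i) (b i :: L (a i)) (b i))) := by
  have m1 : ∀ u w, w ∈ Function.update L (a i) (b i :: L (a i)) u ↔
      w ∈ L u ∨ (u = a i ∧ w = b i) := fun u w => by
    by_cases hu : u = a i
    · subst hu
      rw [Function.update_self, List.mem_cons]
      tauto
    · rw [Function.update_of_ne hu]
      tauto
  intro u w
  have m2 : w ∈ Function.update (Function.update L (a i) (b i :: L (a i))) (b i)
      (a i :: Function.update L (a i) (b i :: L (a i)) (b i)) u ↔
      w ∈ L u ∨ (u = a i ∧ w = b i) ∨ (u = b i ∧ w = a i) := by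
    by_cases hu : u = b i
    · subst hu
      rw [Function.update_self, List.mem_cons, m1]
      tauto
    · rw [Function.update_of_ne hu, m1]
      tauto
  rw [m2, h u w]
  constructor
  · rintro (⟨j, hj, h1⟩ | h1)
    · exact ⟨j, by omega, h1⟩
    · exact ⟨i, by omega, h1⟩
  · rintro ⟨j, hj, h1⟩
    rcases Nat.lt_succ_iff_lt_or_eq.1 hj with hj | rfl
    · exact Or.inl ⟨j, hj, h1⟩
    · exact Or.inr h1

theorem runs_readEdges (h1 : s.reg 1 = m) (h2 : s.reg 2 = 1) (h4 : s.reg 4 = 1)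
    (h16 : s.reg 16 = 0) (ha4 : ∀ v, s.arr 4 v = 0)
    (hlt : ∀ j < m, s.arr 0 j < n ∧ s.arr 1 j < n) (hW : 2 * m + 1 ≤ W)
    (hk : 20 * m + 1 + r ≤ k) :
    Runs W readEdges s k fun k' s' => r ≤ k' ∧
      (∀ x, x ≠ 4 → x ≠ 8 → x ≠ 12 → x ≠ 13 → x ≠ 16 → s'.reg x = s.reg x) ∧
      (∀ A, A ≠ 4 → A ≠ 5 → A ≠ 6 → s'.arr A = s.arr A) ∧ s'.reg 4 = 2 * m + 1 ∧
      ∃ L, Heap s' L ∧ ListsPairs (s.arr 0) (s.arr 1) m L ∧ totalLength n L = 2 * m := by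
  refine (runs_loop (fun k s' =>
      (∀ x, x ≠ 4 → x ≠ 8 → x ≠ 12 → x ≠ 13 → x ≠ 16 → s'.reg x = s.reg x) ∧
      (∀ A, A ≠ 4 → A ≠ 5 → A ≠ 6 → s'.arr A = s.arr A) ∧ s'.reg 16 ≤ m ∧
      20 * (m - s'.reg 16) + 1 + r ≤ k ∧ s'.reg 4 = 2 * s'.reg 16 + 1 ∧
      ∃ L, Heap s' L ∧ ListsPairs (s.arr 0) (s.arr 1) (s'.reg 16) L ∧
        totalLength n L = 2 * s'.reg 16) (fun k s' ⟨_, _, _, h, _⟩ => by omega) ?_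
      ⟨fun _ _ _ _ _ _ => rfl, fun _ _ _ _ => rfl, by omega, by rw [h16]; omega,
        by rw [h16, h4], fun _ => [], ⟨by omega, fun v => ha4 v⟩, ?_, ?_⟩).mono ?_
  · rintro k s₁ ⟨hr, ha, hm, hk, hf, L, hL, hP, hT⟩ hb
    simp only [Test.Holds, hr 1 (by omega) (by omega) (by omega) (by omega) (by omega), h1] at hb
    have r2 : s₁.reg 2 = 1 :=
      (hr 2 (by omega) (by omega) (by omega) (by omega) (by omega)).trans h2
    obtain ⟨hu, hv⟩ := hlt _ hb
    apply runs_load (by omega)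
    apply runs_load (by omega)
    simp only [State.reg_setReg, State.arr_setReg, Nat.reduceEqDiff, if_false,
      ha 0 (by omega) (by omega) (by omega), ha 1 (by omega) (by omega) (by omega)]
    obtain ⟨i, hi⟩ : ∃ i, i = s₁.reg 16 := ⟨_, rfl⟩
    rw [← hi] at hb hu hv hP hT hf hk ⊢
    obtain ⟨s₂, hs₂⟩ : ∃ s₂ : State, s₂ = (s₁.setReg 8 (s.arr 0 i)).setReg 12 (s.arr 1 i) :=
      ⟨_, rfl⟩
    rw [← hs₂]
    have hr₂ : ∀ x, x ≠ 8 → x ≠ 12 → s₂.reg x = s₁.reg x := fun x x8 x12 => by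
      simp [hs₂, x8, x12]
    have r8 : s₂.reg 8 = s.arr 0 i := by simp [hs₂]
    have r12 : s₂.reg 12 = s.arr 1 i := by simp [hs₂]
    have hL₂ : Heap s₂ L := hL.congr (hr₂ 4 (by omega) (by omega)) (by simp [hs₂]) (by simp [hs₂])
      (by simp [hs₂])
    refine runs_cons (runs_push (by omega) hL₂ (by rw [hr₂ 2 (by omega) (by omega), r2])
      (by rw [hr₂ 4 (by omega) (by omega)]; omega) (by omega) fun s₃ P₃ => ?_)
    refine runs_cons (runs_push (by omega) P₃.heap
      (by rw [P₃.reg 2 (by omega) (by omega), hr₂ 2 (by omega) (by omega), r2])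
      (by rw [P₃.free, hr₂ 4 (by omega) (by omega)]; omega) (by omega) fun s₄ P₄ => ?_)
    have hr₄ : ∀ x, x ≠ 4 → x ≠ 8 → x ≠ 12 → x ≠ 13 → s₄.reg x = s₁.reg x :=
      fun x x4 x8 x12 x13 => by rw [P₄.reg x x4 x13, P₃.reg x x4 x13, hr₂ x x8 x12]
    have r16 : s₄.reg 16 = i := by rw [hr₄ 16 (by omega) (by omega) (by omega) (by omega), hi]
    have r2' : s₄.reg 2 = 1 := by rw [hr₄ 2 (by omega) (by omega) (by omega) (by omega), r2]
    have hheap := P₄.heap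
    rw [P₃.reg 8 (by omega) (by omega), P₃.reg 12 (by omega) (by omega), r8, r12] at hheap
    apply runs_plus (by omega) (by rw [r16, r2']; omega)
    rw [r16, r2']
    refine runs_nil (by omega) ⟨?_, ?_, ?_, ?_, ?_, _, hheap.congr (by simp) (by simp) (by simp)
      (by simp), ?_, ?_⟩
    · intro x x4 x8 x12 x13 x16
      simp only [State.reg_setReg, if_neg x16]
      rw [hr₄ x x4 x8 x12 x13, hr x x4 x8 x12 x13 x16]
    · intro A a4 a5 a6
      rw [State.arr_setReg, P₄.arr A a4 a5 a6, P₃.arr A a4 a5 a6, ← ha A a4 a5 a6]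
      simp [hs₂]
    · simp
      omega
    · simp
      omega
    · simp [P₄.free, P₃.free, hr₂ 4, hf]
      omega
    · simpa using hP.succ
    · have e1 := totalLength_update hu L (s.arr 1 i :: L (s.arr 0 i))
      have e2 := totalLength_update hv (Function.update L (s.arr 0 i)
        (s.arr 1 i :: L (s.arr 0 i))) (s.arr 0 i :: Function.update L (s.arr 0 i)
          (s.arr 1 i :: L (s.arr 0 i)) (s.arr 1 i))
      simp only [List.length_cons] at e1 e2
      simp only [State.reg_setReg, if_true]
      omega
  · intro u w
    simp [h16]
  · simp [totalLength, h16]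
  · rintro k' s' - ⟨⟨hr, ha, hm, hk, hf, L, hL, hP, hT⟩, hb⟩
    simp only [Test.Holds, hr 1 (by omega) (by omega) (by omega) (by omega) (by omega), h1,
      not_lt] at hb
    have : s'.reg 16 = m := by omega
    rw [this] at hf hP hT
    exact ⟨by omega, hr, ha, hf, L, hL, hP, hT⟩

/-- All vertices start in the queue, so the queue condition holds whatever the degrees. The `m`
edges occupy `2 * m` cells; address `0` is the end marker, so the first free cell becomes `2 * m +
1`. -/
theorem runs_build {E : ℕ → ℕ → Prop} (h0 : s.reg 0 = n) (h1 : s.reg 1 = m)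
    (hr : ∀ x, 2 ≤ x → s.reg x = 0) (ha : ∀ A, 4 ≤ A → ∀ i, s.arr A i = 0)
    (hlt : ∀ j < m, s.arr 0 j < n ∧ s.arr 1 j < n) (hE : HasWidthTwo E)
    (hEne : ∀ u w, E u w → u ≠ w)
    (hEs : ∀ u w, E u w ↔ ∃ j < m, (u = s.arr 0 j ∧ w = s.arr 1 j) ∨
      (u = s.arr 1 j ∧ w = s.arr 0 j))
    (hW : 2 * m + n + 1 ≤ W) (hk : 4 * n + 20 * m + 10 + r ≤ k) :
    Runs W build s k fun k' s' => r ≤ k' ∧ ∃ L,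
      Invariant n (2 * m + 1) E (fun _ => False) L s' ∧
      potential n L s' = 1000 * n + 80 * m + 2 := by
  apply runs_const (by omega) (by omega)
  apply runs_const (by omega) (by omega)
  refine runs_cons ((runs_fillQueue (n := n) (r := 20 * m + 5 + r) (by simpa using h0) (by simp)
    (by simpa using hr 15 (by omega)) (by omega) (by omega)).mono ?_)
  rintro k₁ s₁ - ⟨hk₁, hr₁, ha₁, hq₁⟩
  have a₁ : ∀ A, A ≠ 7 → s₁.arr A = s.arr A := fun A hA => by simpa using ha₁ A hA
  refine runs_cons ((runs_readEdges (n := n) (m := m) (r := 4 + r) ?_ ?_ ?_ ?_ ?_ ?_ (by omega)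
    (by omega)).mono ?_)
  · simpa [h1] using hr₁ 1 (by omega)
  · simpa using hr₁ 2 (by omega)
  · simpa using hr₁ 4 (by omega)
  · simpa [hr 16] using hr₁ 16 (by omega)
  · rw [a₁ 4 (by omega)]
    exact ha 4 (by omega)
  · rw [a₁ 0 (by omega), a₁ 1 (by omega)]
    exact hlt
  rintro k₂ s₂ - ⟨hk₂, hr₂, ha₂, hf, L, hL, hP, hT⟩
  rw [a₁ 0 (by omega), a₁ 1 (by omega)] at hP
  have hreg : ∀ x, x ≠ 2 → x ≠ 4 → x ≠ 8 → x ≠ 12 → x ≠ 13 → x ≠ 15 → x ≠ 16 →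
      s₂.reg x = s.reg x := fun x x2 x4 x8 x12 x13 x15 x16 => by
    rw [hr₂ x x4 x8 x12 x13 x16, hr₁ x x15]
    simp [x2, x4]
  have r0 : s₂.reg 0 = n := by
    rw [hreg 0 (by omega) (by omega) (by omega) (by omega) (by omega) (by omega) (by omega), h0]
  have r3 : s₂.reg 3 = 0 := by
    rw [hreg 3 (by omega) (by omega) (by omega) (by omega) (by omega) (by omega) (by omega),
      hr 3 (by omega)]
  have r6 : s₂.reg 6 = 0 := by
    rw [hreg 6 (by omega) (by omega) (by omega) (by omega) (by omega) (by omega) (by omega),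
      hr 6 (by omega)]
  have r2 : s₂.reg 2 = 1 := by
    rw [hr₂ 2 (by omega) (by omega) (by omega) (by omega) (by omega), hr₁ 2 (by omega)]
    simp
  have a0 : ∀ A, 8 ≤ A → ∀ i, s₂.arr A i = 0 := fun A hA i => by
    rw [ha₂ A (by omega) (by omega) (by omega), a₁ A (by omega), ha A (by omega)]
  have a7 : ∀ i < n, s₂.arr 7 i = i := by
    rw [ha₂ 7 (by omega) (by omega) (by omega)]
    exact hq₁
  have hLE : ∀ u w, w ∈ L u ↔ E u w := fun u w => (hP u w).trans (hEs u w).symm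
  have hLn : ∀ u w, w ∈ L u → w < n := by
    intro u w hw
    obtain ⟨j, hj, ⟨-, rfl⟩ | ⟨-, rfl⟩⟩ := (hP u w).1 hw
    exacts [(hlt j hj).2, (hlt j hj).1]
  have hLs : ∀ u w, w ∈ L u → u ∈ L w := by
    intro u w hw
    rw [hP] at hw ⊢
    obtain ⟨j, hj, h⟩ := hw
    exact ⟨j, hj, by tauto⟩
  apply runs_move (by omega)
  apply runs_move (by omega)
  refine runs_nil (by omega) ⟨by omega, L, ⟨?_, ?_, ?_, ?_, ?_, ?_, ?_, ?_, ?_, ?_⟩, ?_⟩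
  · simpa using r0
  · simpa using r2
  · simpa using r3
  · exact hL.congr (by simp) (by simp) (by simp) (by simp)
  · simp only [State.reg_setReg, State.arr_setReg, Nat.reduceEqDiff, if_true, if_false, r0]
    refine ⟨hLn, fun u w _ _ => hLs u w, ?_, ?_, ?_, ?_, ?_, fun u w huw => ⟨hEne u w huw, ?_⟩⟩
    · exact hE.mono fun u w h => (hLE u w).1 h.2.2.2
    · simp [a0 8]
    · intro v hv
      exact absurd (a0 8 (by omega) v) hv
    · intro k h1 h2
      omega
    · intro k h1 h2
      omega
    · have := (hLE u w).2 huw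
      exact Or.inl ⟨a0 8 (by omega) u, a0 8 (by omega) w, this, hLs u w this⟩
  · intro u hu _ _ _
    exact ⟨u, by simp [r6], by simpa [r0] using hu, by simpa using a7 u hu⟩
  · intro i hi
    have hi' : i < n := by simpa [r0] using hi
    simpa [a7 i hi'] using hi'
  · simp [r6]
  · simp [r0]
    omega
  · simp [hf]
  · simp [potential, r0, r6, hT]
    omega

end RAM.Program

/-! ### Reading off the decomposition -/

namespace RAM.Program

/-- Compute in the registers `10` and `11` the pair of ranks to which the vertex with the rank in
register `7` is attached, from the ranks of its recorded neighbours in the registers `8`, `9`. -/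
def choosePair : Program :=
  branch (.lt 8 9) (block [move 10 9, move 11 8])
    (branch (.lt 9 8) (block [move 10 8, move 11 9])
      (branch (.lt 8 7)
        (branch (.le 5 8) (block [move 10 8, load 11 13 8]) (block [move 10 5, move 11 2]))
        (block [move 10 5, move 11 2])))

/-- Output the bag of the vertex with the rank in register `7`. -/
def outputBag : Program :=
  block [load 8 10 7, load 9 11 7, load 8 8 8, load 9 8 9, choosePair, store 12 7 10,
    store 13 7 11, minus 14 7 6, load 15 9 7, store 0 14 15, load 15 9 10, store 1 14 15,
    load 15 9 11, store 2 14 15, minus 15 10 6, store 3 14 15, plus 7 7 2]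

/-- Output the decomposition. -/
def output : Program :=
  block [const 5 2, const 6 3, move 7 6, store 13 5 2, loop (.le 7 0) outputBag, minus 0 0 5,
    move 1 3]

end RAM.Program

/-- The vertex with rank `k` is attached to the pair of ranks `l < h`. -/
structure AttachedTo (R A B hi lo : ℕ → ℕ) (k h l : ℕ) : Prop where
  pos : 1 ≤ l
  lo_lt : l < h
  hi_lt : h < k
  pair : 3 ≤ h → l = hi h ∨ l = lo h
  mem : ∀ u, u = A k ∨ u = B k → R u < k → R u = h ∨ R u = l

/-- Only the entries at `h < k` are consulted, so writing the pair of rank `k` does not disturb the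
pairs already chosen. -/
theorem AttachedTo.congr {R A B hi lo hi' lo' : ℕ → ℕ} {k h l : ℕ}
    (hA : AttachedTo R A B hi lo k h l) (hhi : ∀ j < k, hi' j = hi j) (hlo : ∀ j < k, lo' j = lo j) :
    AttachedTo R A B hi' lo' k h l := by
  refine ⟨hA.pos, hA.lo_lt, hA.hi_lt, fun h3 => ?_, hA.mem⟩
  rw [hhi h hA.hi_lt, hlo h hA.hi_lt]
  exact hA.pair h3

namespace Elimination

variable {n : ℕ} {E : ℕ → ℕ → Prop} {R X A B : ℕ → ℕ} {L : ℕ → List ℕ}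

theorem rank_pos (h : Elimination n E R X A B 0 L) {v : ℕ} (hv : v < n) : R v ≠ 0 := by
  intro h0
  exact absurd (h.pos hv h0) (lt_irrefl 0)

/-- Two distinct recorded neighbours are attached consistently. -/
theorem attachedTo_of_ne (h : Elimination n E R X A B 0 L) {hi lo : ℕ → ℕ} {k : ℕ} (hk0 : 0 < k)
    (hkn : k ≤ n) (hprev : ∀ j, 3 ≤ j → j < k → AttachedTo R A B hi lo j (hi j) (lo j))
    (hne : R (A k) ≠ R (B k)) :
    AttachedTo R A B hi lo k (max (R (A k)) (R (B k))) (min (R (A k)) (R (B k))) := by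
  obtain ⟨hA, hB, hAB⟩ := h.attach k hk0 hkn
  have hA0 := h.rank_pos hA
  have hB0 := h.rank_pos hB
  obtain ⟨hAk, hBk, hrec⟩ : R (A k) < k ∧ R (B k) < k ∧ Recorded R A B L (A k) (B k) := by
    rcases hAB with h1 | ⟨h1, h2, h3⟩
    · exact absurd (by rw [h1.1, h1.2]) hne
    · exact ⟨h1, h2, h3.resolve_left fun h4 => hne (by rw [h4])⟩
  refine ⟨by omega, by omega, by omega, fun h3 => ?_, ?_⟩
  -- No rank is `0` any more, so one of the two vertices is a recorded neighbour of the other, which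
  -- has the larger rank; the attachment of that larger rank places it in its pair.
  · rcases hrec with ⟨h1, -⟩ | ⟨h1, h2⟩ | ⟨h1, h2⟩
    · exact absurd h1 hA0
    · rw [max_eq_left h1.le, min_eq_right h1.le] at *
      have := (hprev _ h3 hAk).mem (B k) h2 h1
      tauto
    · rw [max_eq_right h1.le, min_eq_left h1.le] at *
      have := (hprev _ h3 hBk).mem (A k) h2 h1
      tauto
  · rintro u (rfl | rfl) - <;> omega

end Elimination

namespace RAM.Program

variable {n W k r : ℕ} {s : State} {E : ℕ → ℕ → Prop} {X : ℕ → ℕ} {L : ℕ → List ℕ}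

/-- Two distinct neighbours form the pair themselves. A single neighbour of rank `h ≥ 2` is
completed by `lo h`. If the single neighbour has rank `1`, or there is none (the recorded rank is
then `k` itself), the pair `{2, 1}` serves. -/
theorem runs_choosePair {R A B : ℕ → ℕ} {Q : ℕ → State → Prop}
    (h : Elimination n E R X A B 0 L)
    (h2 : s.reg 2 = 1) (h5 : s.reg 5 = 2) (h7 : 3 ≤ s.reg 7) (h7n : s.reg 7 ≤ n)
    (h8 : s.reg 8 = R (A (s.reg 7))) (h9 : s.reg 9 = R (B (s.reg 7))) (h13 : s.arr 13 2 = 1)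
    (hprev : ∀ j, 3 ≤ j → j < s.reg 7 →
      AttachedTo R A B (s.arr 12) (s.arr 13) j (s.arr 12 j) (s.arr 13 j))
    (hk : 10 ≤ k)
    (hQ : ∀ k' h l, k ≤ k' + 7 → AttachedTo R A B (s.arr 12) (s.arr 13) (s.reg 7) h l →
      Q k' ((s.setReg 10 h).setReg 11 l)) :
    Runs W choosePair s k Q := by
  have hne := h.attachedTo_of_ne (by omega) h7n hprev
  obtain ⟨hA, hB, -⟩ := h.attach (s.reg 7) (by omega) h7n
  have hA0 := h.rank_pos hA
  refine runs_branch (by omega) (fun hb => ?_) fun hb => ?_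
  · simp only [Test.Holds] at hb
    apply runs_move (by omega)
    apply runs_move (by omega)
    refine runs_nil (by omega) ?_
    simp only [State.reg_setReg, Nat.reduceEqDiff, if_false]
    apply hQ _ _ _ (by omega)
    have := hne (by omega)
    rwa [max_eq_right (by omega), min_eq_left (by omega), ← h8, ← h9] at this
  refine runs_branch (by omega) (fun hb' => ?_) fun hb' => ?_
  · simp only [Test.Holds] at hb'
    apply runs_move (by omega)
    apply runs_move (by omega)
    refine runs_nil (by omega) ?_
    simp only [State.reg_setReg, Nat.reduceEqDiff, if_false]
    apply hQ _ _ _ (by omega)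
    have := hne (by omega)
    rwa [max_eq_left (by omega), min_eq_right (by omega), ← h8, ← h9] at this
  simp only [Test.Holds] at hb hb'
  have heq : ∀ u, u = A (s.reg 7) ∨ u = B (s.reg 7) → R u = s.reg 8 := by
    rintro u (rfl | rfl) <;> omega
  have hdef : (s.reg 8 < s.reg 7 → s.reg 8 < 2) →
      AttachedTo R A B (s.arr 12) (s.arr 13) (s.reg 7) 2 1 := by
    intro h1
    refine ⟨by omega, by omega, by omega, fun h3 => by omega, fun u hu hlt => ?_⟩
    have := heq u hu
    omega
  have hdefault : ∀ k₂, (s.reg 8 < s.reg 7 → s.reg 8 < 2) → 3 ≤ k₂ → k ≤ k₂ + 4 →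
      Runs W (block [move 10 5, move 11 2]) s k₂ Q := by
    intro k₂ h1 hk₂ hk₂'
    apply runs_move (by omega)
    apply runs_move (by omega)
    refine runs_nil (by omega) ?_
    simp only [State.reg_setReg, Nat.reduceEqDiff, if_false, h5, h2]
    exact hQ _ _ _ (by omega) (hdef h1)
  refine runs_branch (by omega) (fun hlt => ?_) fun hlt => ?_
  · simp only [Test.Holds] at hlt
    refine runs_branch (by omega) (fun hle => ?_) fun hle => ?_
    · simp only [Test.Holds, h5] at hle
      apply runs_move (by omega)
      apply runs_load (by omega)
      refine runs_nil (by omega) ?_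
      simp only [State.reg_setReg, State.arr_setReg, Nat.reduceEqDiff, if_false]
      apply hQ _ _ _ (by omega)
      -- Rank `2` has no attached pair; the preset entry `lo 2 = 1` makes the load correct there
      -- too.
      have hlo : 1 ≤ s.arr 13 (s.reg 8) ∧ s.arr 13 (s.reg 8) < s.reg 8 := by
        by_cases h3 : 3 ≤ s.reg 8
        · have := hprev _ h3 hlt
          exact ⟨this.pos, this.lo_lt.trans this.hi_lt⟩
        · rw [show s.reg 8 = 2 by omega, h13]
          omega
      exact ⟨hlo.1, hlo.2, hlt, fun _ => Or.inr rfl, fun u hu _ => Or.inl (heq u hu)⟩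
    · simp only [Test.Holds, h5] at hle
      exact hdefault _ (by omega) (by omega) (by omega)
  · simp only [Test.Holds] at hlt
    exact hdefault _ (by omega) (by omega) (by omega)

/-- The bag of the vertex with rank `j` has been output. -/
structure BagOutput (X : ℕ → ℕ) (s : State) (j : ℕ) : Prop where
  fst : s.arr 0 (j - 3) = X j
  snd : s.arr 1 (j - 3) = X (s.arr 12 j)
  thd : s.arr 2 (j - 3) = X (s.arr 13 j)
  father : s.arr 3 (j - 3) = s.arr 12 j - 3

/-- The invariant of the output loop. -/
structure OutputInvariant (n : ℕ) (R X A B : ℕ → ℕ) (s : State) : Prop where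
  size : s.reg 0 = n
  one : s.reg 2 = 1
  zero : s.reg 3 = 0
  two : s.reg 5 = 2
  three : s.reg 6 = 3
  three_le : 3 ≤ s.reg 7
  le : s.reg 7 ≤ n + 1
  rank : s.arr 8 = R
  vertex : s.arr 9 = X
  fst : s.arr 10 = A
  snd : s.arr 11 = B
  base : s.arr 13 2 = 1
  attached : ∀ j, 3 ≤ j → j < s.reg 7 →
    AttachedTo R A B (s.arr 12) (s.arr 13) j (s.arr 12 j) (s.arr 13 j)
  bag : ∀ j, 3 ≤ j → j < s.reg 7 → BagOutput X s j

/-- Bags overwrite the input edges, which are not read again. Rank `j` goes to index `j - 3`, and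
the father index truncates in the same way. -/
theorem runs_outputBag {R A B : ℕ → ℕ} (h : OutputInvariant n R X A B s)
    (hE : Elimination n E R X A B 0 L) (h7 : s.reg 7 ≤ n) (hW : n + 1 ≤ W) (hk : 30 + r ≤ k) :
    Runs W outputBag s k fun k' s' => r ≤ k' ∧ OutputInvariant n R X A B s' ∧
      s'.reg 7 = s.reg 7 + 1 := by
  have h3 := h.three_le
  apply runs_load (by omega)
  apply runs_load (by omega)
  apply runs_load (by omega)
  apply runs_load (by omega)
  simp only [State.reg_setReg, State.arr_setReg, Nat.reduceEqDiff, if_true, if_false, h.rank,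
    h.fst, h.snd]
  refine runs_cons (runs_choosePair hE ?_ ?_ ?_ ?_ ?_ ?_ ?_ ?_ (by omega)
    fun k₂ hh ll hk₂ hat => ?_)
  · simpa using h.one
  · simpa using h.two
  · simpa using h.three_le
  · simpa using h7
  · simp
  · simp
  · simpa using h.base
  · simpa using h.attached
  simp only [State.reg_setReg, State.arr_setReg, Nat.reduceEqDiff, if_false] at hat
  apply runs_store (by omega)
  apply runs_store (by omega)
  apply runs_minus (by omega)
  apply runs_load (by omega)
  apply runs_store (by omega)
  apply runs_load (by omega)
  apply runs_store (by omega)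
  apply runs_load (by omega)
  apply runs_store (by omega)
  apply runs_minus (by omega)
  apply runs_store (by omega)
  apply runs_plus (by omega)
  · simp [h.one]
    omega
  apply runs_nil (by omega)
  simp only [State.reg_setReg, State.reg_setArr, State.arr_setReg, State.arr_setArr,
    Nat.reduceEqDiff, if_true, if_false, h.vertex, h.one, h.three]
  refine ⟨by omega, ⟨?_, ?_, ?_, ?_, ?_, ?_, ?_, ?_, ?_, ?_, ?_, ?_, ?_, ?_⟩, ?_⟩
  · simp [h.size]
  · simp [h.one]
  · simp [h.zero]
  · simp [h.two]
  · simp [h.three]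
  · simp
    omega
  · simpa using h7
  · simp [h.rank]
  · simp [h.vertex]
  · simp [h.fst]
  · simp [h.snd]
  · simp only [State.arr_setReg, State.arr_setArr, Nat.reduceEqDiff, if_true, if_false]
    rw [Function.update_of_ne (by omega), h.base]
  · simp only [State.reg_setReg, State.reg_setArr, State.arr_setReg, State.arr_setArr,
      Nat.reduceEqDiff, if_true, if_false]
    intro j hj3 hj
    by_cases hjk : j = s.reg 7
    · subst hjk
      rw [Function.update_self, Function.update_self]
      exact hat.congr (fun i hi => Function.update_of_ne (by omega) _ _)
        fun i hi => Function.update_of_ne (by omega) _ _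
    · rw [Function.update_of_ne hjk, Function.update_of_ne hjk]
      exact (h.attached j hj3 (by omega)).congr (fun i hi => Function.update_of_ne (by omega) _ _)
        fun i hi => Function.update_of_ne (by omega) _ _
  · simp only [State.reg_setReg, State.reg_setArr, Nat.reduceEqDiff, if_true, if_false]
    intro j hj3 hj
    by_cases hjk : j = s.reg 7
    · subst hjk
      constructor <;> simp
    · have hj' := h.bag j hj3 (by omega)
      have hne : j - 3 ≠ s.reg 7 - 3 := by omega
      constructor <;> simp [hjk, hne, hj'.fst, hj'.snd, hj'.thd, hj'.father]
  · simp

theorem runs_output {R A B : ℕ → ℕ} (hE : Elimination n E R X A B 0 L) (hn : 3 ≤ n)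
    (h0 : s.reg 0 = n) (h2 : s.reg 2 = 1) (h3 : s.reg 3 = 0) (hR : s.arr 8 = R)
    (hX : s.arr 9 = X) (hA : s.arr 10 = A) (hB : s.arr 11 = B) (hW : n + 1 ≤ W)
    (hk : 40 * n + 10 ≤ k) :
    Runs W output s k fun _ s' => s'.reg 0 = n - 2 ∧ s'.reg 1 = 0 ∧
      ∀ j, 3 ≤ j → j ≤ n → BagOutput X s' j ∧
        AttachedTo R A B (s'.arr 12) (s'.arr 13) j (s'.arr 12 j) (s'.arr 13 j) := by
  apply runs_const (by omega) (by omega)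
  apply runs_const (by omega) (by omega)
  apply runs_move (by omega)
  apply runs_store (by omega)
  apply runs_cons
  simp only [State.reg_setReg, Nat.reduceEqDiff, if_true, if_false, h2]
  refine (runs_loop (fun k s => OutputInvariant n R X A B s ∧ 40 * (n + 1 - s.reg 7) + 5 ≤ k)
    (fun k s h => by omega) (fun k s h hb => ?_) ?_).mono fun k₂ s₂ _ h => ?_
  · obtain ⟨h, hk⟩ := h
    simp only [Test.Holds, h.size] at hb
    refine (runs_outputBag (r := 40 * (n + 1 - (s.reg 7 + 1)) + 5) h hE hb hW (by omega)).mono ?_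
    rintro k' s' - ⟨h1, h2, h3⟩
    exact ⟨h2, by rw [h3]; exact h1⟩
  · refine ⟨⟨?_, ?_, ?_, ?_, ?_, ?_, ?_, ?_, ?_, ?_, ?_, ?_, ?_, ?_⟩, ?_⟩
    · simpa using h0
    · simpa using h2
    · simpa using h3
    · simp
    · simp
    · simp
    · simp
      omega
    · simpa using hR
    · simpa using hX
    · simpa using hA
    · simpa using hB
    · simp
    · intro j h1 h2
      simp at h2
      omega
    · intro j h1 h2
      simp at h2
      omega
    · simp
      omega
  · obtain ⟨⟨h, hk⟩, hb⟩ := h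
    simp only [Test.Holds, h.size, not_le] at hb
    apply runs_minus (by omega)
    apply runs_move (by omega)
    refine runs_nil (by omega) ⟨by simp [h.size, h.two], by simp [h.zero], fun j h1 h2 => ?_⟩
    have hb := h.bag j h1 (by omega)
    exact ⟨⟨by simpa using hb.fst, by simpa using hb.snd, by simpa using hb.thd,
      by simpa using hb.father⟩, by simpa using h.attached j h1 (by omega)⟩

end RAM.Program

/-! ### The main theorem -/

/-- The same execution works with a larger initial credit, and the excess is still there at the end.
-/
theorem RAM.Program.Runs.frame {W k : ℕ} {p : Program} {s : State} {Q : ℕ → State → Prop}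
    (h : Runs W p s k Q) (r : ℕ) :
    Runs W p s (k + r) fun k' s' => r ≤ k' ∧ ∃ k'', Q k'' s' := by
  obtain ⟨t, s', k', h1, h2, h3⟩ := h
  exact ⟨t, s', k' + r, h1, by omega, by omega, k', h3⟩

/-- The program computing the decomposition. -/
def decompose : Program := block [build, reduce, output]

section

variable {n : ℕ} {G : SimpleGraph (Fin n)} {es : List (Fin n × Fin n)}

/-- Adjacency of vertices given as numbers. -/
def natAdj (G : SimpleGraph (Fin n)) (u v : ℕ) : Prop :=
  ∃ a b : Fin n, (a : ℕ) = u ∧ (b : ℕ) = v ∧ G.Adj a b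

theorem natAdj.ne {u v : ℕ} (h : natAdj G u v) : u ≠ v := by
  obtain ⟨a, b, rfl, rfl, hab⟩ := h
  exact fun hcon => hab.ne (Fin.ext hcon)

/-- Each edge occurs once, so the edge bound for width two makes costs that are linear in the list
length linear in `n`. -/
theorem IsEdgeList.length_le (hes : IsEdgeList G es) (hG : HasWidthTwo (natAdj G)) :
    es.length ≤ 2 * n := by
  classical
  let F : List (Sym2 ℕ) := (es.map fun e => s(e.1, e.2)).map (Sym2.map Fin.val)
  have hF : F.Nodup := hes.1.map (Sym2.map.injective Fin.val_injective)
  have hmem : ∀ e ∈ F, ∃ a b : Fin n, e = s((a : ℕ), (b : ℕ)) ∧ G.Adj a b := by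
    intro e he
    obtain ⟨e', he', rfl⟩ := List.mem_map.1 he
    induction e' using Sym2.ind with
    | _ a b => exact ⟨a, b, rfl, (hes.2 a b).2 he'⟩
  have h := hG.card_edges_le (fun u v => natAdj.ne) F.toFinset (fun u v huv => by
    obtain ⟨a, b, hab, hadj⟩ := hmem _ (List.mem_toFinset.1 huv)
    rcases Sym2.eq_iff.1 hab with ⟨rfl, rfl⟩ | ⟨rfl, rfl⟩
    exacts [⟨a, b, rfl, rfl, hadj⟩, ⟨b, a, rfl, rfl, hadj.symm⟩]) (Finset.range n)
  rw [Finset.filter_true_of_mem, List.toFinset_card_of_nodup hF, Finset.card_range] at h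
  · simpa [F] using h
  · intro e he u hu
    obtain ⟨a, b, rfl, -⟩ := hmem e (List.mem_toFinset.1 he)
    rcases Sym2.mem_iff.1 hu with rfl | rfl
    exacts [Finset.mem_range.2 a.2, Finset.mem_range.2 b.2]

theorem graphInput_endpoints {j : ℕ} (hj : j < es.length) :
    (graphInput n es).arr 0 j = (es[j].1 : ℕ) ∧ (graphInput n es).arr 1 j = (es[j].2 : ℕ) := by
  simp [graphInput, hj]

theorem IsEdgeList.natAdj_iff (hes : IsEdgeList G es) (u w : ℕ) :
    natAdj G u w ↔ ∃ j < es.length,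
      (u = (graphInput n es).arr 0 j ∧ w = (graphInput n es).arr 1 j) ∨
        (u = (graphInput n es).arr 1 j ∧ w = (graphInput n es).arr 0 j) := by
  constructor
  · rintro ⟨a, b, rfl, rfl, hab⟩
    obtain ⟨e, he, heq⟩ := List.mem_map.1 ((hes.2 a b).1 hab)
    obtain ⟨j, hj, rfl⟩ := List.getElem_of_mem he
    refine ⟨j, hj, ?_⟩
    obtain ⟨h0, h1⟩ := graphInput_endpoints hj
    rw [h0, h1]
    rcases Sym2.eq_iff.1 heq with ⟨h2, h3⟩ | ⟨h2, h3⟩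
    · exact Or.inl ⟨by rw [h2], by rw [h3]⟩
    · exact Or.inr ⟨by rw [h3], by rw [h2]⟩
  · rintro ⟨j, hj, h⟩
    have hadj : G.Adj es[j].1 es[j].2 :=
      (hes.2 _ _).2 (List.mem_map.2 ⟨es[j], List.getElem_mem hj, rfl⟩)
    obtain ⟨h0, h1⟩ := graphInput_endpoints hj
    rw [h0, h1] at h
    rcases h with ⟨rfl, rfl⟩ | ⟨rfl, rfl⟩
    exacts [⟨_, _, rfl, rfl, hadj⟩, ⟨_, _, rfl, rfl, hadj.symm⟩]

/-- The program halts within the time and word bounds with the output of an elimination. -/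
theorem runs_decompose (hn : 3 ≤ n) (hes : IsEdgeList G es) (hG : HasWidthTwo (natAdj G)) :
    Runs (2000 * n) decompose (graphInput n es) (2000 * n) fun _ s => s.reg 0 = n - 2 ∧
      s.reg 1 = 0 ∧ ∃ R X A B L, Elimination n (natAdj G) R X A B 0 L ∧
        ∀ j, 3 ≤ j → j ≤ n → BagOutput X s j ∧
          AttachedTo R A B (s.arr 12) (s.arr 13) j (s.arr 12 j) (s.arr 13 j) := by
  have hm := hes.length_le hG
  -- With at most `2 * n` edges, building leaves `1500 * n` of the credit; the potential is at most
  -- `1160 * n + 2`, and what remains suffices for the output.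
  refine runs_cons ((runs_build (n := n) (m := es.length) (r := 1500 * n) (E := natAdj G)
    (by simp [graphInput]) (by simp [graphInput]) ?_ ?_ ?_ hG (fun u w => natAdj.ne)
    hes.natAdj_iff (by omega) (by omega)).mono ?_)
  · intro x hx
    simp [graphInput, show x ≠ 0 by omega, show x ≠ 1 by omega]
  · intro A hA i
    simp [graphInput, show A ≠ 0 by omega, show A ≠ 1 by omega]
  · intro j hj
    obtain ⟨h0, h1⟩ := graphInput_endpoints hj
    rw [h0, h1]
    exact ⟨es[j].1.2, es[j].2.2⟩
  rintro k₁ s₁ - ⟨hk₁, L, hinv, hpot⟩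
  have hred := (runs_reduce (W := 2000 * n) hinv (by omega) le_rfl).frame
    (k₁ - potential n L s₁)
  rw [Nat.add_sub_cancel' (by omega)] at hred
  refine runs_cons (hred.mono ?_)
  rintro k₂ s₂ - ⟨hk₂, -, h0, h2, h3, L', hE⟩
  have hout := (runs_output (W := 2000 * n) (k := k₂ - 1) hE hn h0 h2 h3 rfl rfl rfl rfl
    (by omega) (by omega)).frame 1
  rw [Nat.sub_add_cancel (by omega)] at hout
  exact runs_cons (hout.mono fun k₃ s₃ _ ⟨hk₃, _, q0, q1, q⟩ =>
    runs_nil hk₃ ⟨q0, q1, _, _, _, _, L', hE, q⟩)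

end

theorem Elimination.pairAttachment {n : ℕ} {E : ℕ → ℕ → Prop} {R X A B hi lo : ℕ → ℕ}
    {L : ℕ → List ℕ} (h : Elimination n E R X A B 0 L) (hn : 3 ≤ n)
    (hat : ∀ j, 3 ≤ j → j ≤ n → AttachedTo R A B hi lo j (hi j) (lo j)) :
    PairAttachment n X R hi lo := by
  refine ⟨hn, fun v hv => ?_, fun k h1 h2 => h.vertex k h1 h2, fun k h1 h2 => ?_,
    fun k h1 h2 => (hat k h1 h2).pair⟩
  · obtain ⟨-, h1, h2, h3⟩ := h.rank v (h.rank_pos hv)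
    exact ⟨h1, h2, h3⟩
  · have := hat k h1 h2
    exact ⟨this.pos, this.lo_lt, this.hi_lt⟩

theorem mainTheorem9 :
    ∃ (P : RAM.Program) (C : ℕ),
      ∀ (n : ℕ) (G : SimpleGraph (Fin n)) (es : List (Fin n × Fin n)),
        3 ≤ n → IsPartialKTree 2 G → IsEdgeList G es →
        ∃ (t : ℕ) (s : RAM.State) (r : ℕ) (T : RootedTreeDecomposition G (Fin r)),
          RAM.Exec (C * n) P (graphInput n es) t s ∧
          t ≤ C * n ∧
          Stores s T ∧
          storageWords r ≤ C * n ∧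
          T.IsSmooth ∧
          T.HasCommonFathers ∧
          (treewidth G = 2 → T.IsSuitable) := by
  refine ⟨decompose, 2000, fun n G es hn hG hes => ?_⟩
  obtain ⟨t, s, k', hexec, ht, hs0, hs1, R, X, A, B, L, hE, hout⟩ :=
    runs_decompose hn hes hG.hasWidthTwo
  have hat := fun j h1 h2 => (hout j h1 h2).2
  obtain ⟨T, hroot, hbag, hlink, hsmooth, hfathers⟩ :=
    (hE.pairAttachment hn hat).exists_decomposition G (fun u v huv hlt h3 => by
      have hR := (hE.rank u (hE.rank_pos u.2)).2.2.1
      -- All ranks are positive, so an edge survives only as a record at its endpoint of larger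
      -- rank, where the attached pair covers it.
      rcases (hE.edge u v ⟨u, v, rfl, rfl, huv⟩).2 with ⟨h1, -⟩ | ⟨-, h2⟩ | ⟨h1, -⟩
      · omega
      · exact (hat (R u) h3 hR).mem v h2 hlt
      · omega)
  refine ⟨t, s, n - 2, T, hexec, by omega, ⟨hs0, by rw [hs1, hroot], fun i => ?_,
    fun p c => ?_⟩, by rw [storageWords]; omega, hsmooth, hfathers, fun htw =>
      ⟨?_, hsmooth, hfathers⟩⟩
  · have hb := (hout (i + 3) (by omega) (by omega)).1
    rw [hbag i, ← hb.fst, ← hb.snd, ← hb.thd, Nat.add_sub_cancel]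
  · have hb := (hout (c + 3) (by omega) (by omega)).1.father
    rw [Nat.add_sub_cancel] at hb
    rw [hlink p c, hb]
  · rw [RootedTreeDecomposition.IsOptimal, htw, TreeDecomposition.width]
    simp only [hsmooth.1]
    -- The root makes the index set nonempty, so the largest bag size is `3` and the width is `2`.
    rw [Finset.sup_const ⟨T.root, Finset.mem_univ _⟩]
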